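/- Let $d\ge 1$, $X=[0,1]^d$, and let $\mathcal L$ denote Lebesgue measure on $\mathbb R^d$. For Borel probability measures $\rho,\rho'$ on a compact set $Y\subset\mathbb R^d$ let $$W_Y(\rho,\rho')=\inf_{\gamma\in\Pi(\rho,\rho')}\int |y-y'|\,\mathrm d\gamma(y,y')$$ be the Wasserstein-1 distance for the Euclidean norm, where $\Pi(\cdot,\cdot)$ is the set of measures with the given marginals. For measures $\pi=\mu\otimes\pi_x$, $\pi'=\mu\otimes\pi'_x$ on $X\times Y$ with first marginal $\mu$ and disintegrations $\pi_x,\pi'_x$ let $\mathcal W(\pi,\pi')=\int_X W_Y(\pi_x,\pi'_x)\,\mathrm d\mu(x)$. For $u\in L^1(\mathbb R^d)$ let $$\mathrm{TV}(u)=\sup\Big\{\int_{\mathbb R^d}u\,\operatorname{div}\phi\,\mathrm dx : \phi\in C^1_c(\mathbb R^d;\mathbb R^d),\ |\phi|\le 1\Big\}.$$ *Cells.* For even $n\ge 2$ let $I^n=\{0,\dots,n-1\}^d$ and $X^n_i=i/n+[0,1/n]^d$ for $i\in I^n$. Two partitions of $I^n$ are used: in $\mathcal J^n_A$ the indices $i,j$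 lie in the same block if $\lfloor i_l/2\rfloor=\lfloor j_l/2\rfloor$ for all $l$; in $\mathcal J^n_B$ they do if $\lfloor (i_l+1)/2\rfloor=\lfloor (j_l+1)/2\rfloor$ for all $l$. For a block $J$ put $X^n_J=\bigcup_{i\in J}X^n_i$. Let $\mathcal J^{n,k}=\mathcal J^n_A$ for odd $k$ and $\mathcal J^{n,k}=\mathcal J^n_B$ for even $k$. *Data.* Let $\mu$ be a probability measure on $X$ with $\mu\ll\mathcal L$; extend its density $\mathrm d\mu/\mathrm d\mathcal L$ by $0$ outside $X$. Put $m^n_i=\mu(X^n_i)$ and $m^n_J=\sum_{i\in J}m^n_i$. For each even $n\ge2$ let $\mu^n$ be a probability measure on $X$ with $\mu^n(X^n_i)=m^n_i$ and $\mu^n(\partial X^n_i)=0$ for all $i\in I^n$, let $\nu^n$ be a probability measure on $Y$, let $\pi^n_{\mathrm{init}}\in\Pi(\mu^n,\nu^n)$, let $c^n$ be a bounded measurable function on $X\times Y$, and let $\varepsilon^n\ge 0$. *Iterates.* Let $\pi^{n,0}=\pi^n_{\mathrm{init}}$ and, for $k\ge 0$, let $\pi^{n,k+1}=\sum_{J\in\mathcal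 J^{n,k+1}}\pi^{n,k+1}_J$, where $\pi^{n,k+1}_J$ is a minimizer of $$\int c^n\,\mathrm d\pi+\varepsilon^n\,\mathrm{KL}\big(\pi\,\big|\,\mu^n{\llcorner}X^n_J\otimes\nu^n\big)\quad\text{over}\quad \pi\in\Pi\big(\mu^n{\llcorner}X^n_J,\ \mathrm P_Y(\pi^{n,k}{\llcorner}(X^n_J\times Y))\big)$$ and $\mathrm P_Y$ denotes the second marginal. (The entropy term is absent for $\varepsilon^n=0$. Minimizers need not be unique; the iterates are any sequence obtained in this way.) Put $$\rho^{n,k}_i=\frac{\mathrm P_Y(\pi^{n,k}{\llcorner}(X^n_i\times Y))}{m^n_i},\qquad \rho^{n,k}_J=\frac{\mathrm P_Y(\pi^{n,k}{\llcorner}(X^n_J\times Y))}{m^n_J},$$ $$\mathrm{WTVB}(\pi^{n,k})=\frac1{n^{d-1}}\sum_{\substack{i,i'\in I^n\\ i-i'\in\{2e_1,\dots,2e_d\}}}W_Y(\rho^{n,k}_i,\rho^{n,k}_{i'}).$$ *Trajectories.* For $t\ge 0$ let $\boldsymbol\pi^n_t$ be the measure on $X\times Y$ with first marginal $\mu$ and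 disintegration $\boldsymbol\pi^n_{t,x}=\rho^{n,k}_J$ for $\mu$-a.e. $x\in X^n_J$, $J\in\mathcal J^{n,k}$, where $k=\lfloor nt\rfloor$. **Proposition.** There is a constant $C<\infty$ depending only on $d$ such that the following holds for all $Y$ and all data and iterates as above. Suppose that $M_l\le \mathrm d\mu/\mathrm d\mathcal L\le M_u$ a.e. on $X$ for constants $0<M_l\le M_u<\infty$ and that $\mathrm{TV}(\mathrm d\mu/\mathrm d\mathcal L)<\infty$. Then for all even $n\ge 2$ and all $k\in\{0,1,2,\dots\}$ $$\mathcal W\big(\boldsymbol\pi^n_{k/n},\boldsymbol\pi^n_{(k+1)/n}\big)\le\frac{M_u}{n}\left[C\cdot\mathrm{WTVB}(\pi^{n,k})+2^{d+1}\operatorname{diam}Y\,\frac{\sqrt d}{M_l}\,\mathrm{TV}\Big(\frac{\mathrm d\mu}{\mathrm d\mathcal L}\Big)+2d\operatorname{diam}Y\right].$$ In particular, if $\sup_{n,k}\mathrm{WTVB}(\pi^{n,k})<\infty$ (over even $n\ge2$ and $k\ge0$), then there is $K<\infty$, independent of $n$ and $k$, with $\mathcal W(\boldsymbol\pi^n_{k/n},\boldsymbol\pi^n_{(k+1)/n})\le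 K/n$ for all even $n\ge2$ and $k\ge 0$. -/

import Mathlib

open MeasureTheory ProbabilityTheory
open scoped ENNReal NNReal

noncomputable section

namespace DomDec

/-- The space `ℝ^d` with its Euclidean distance. -/
abbrev Space (d : ℕ) := EuclideanSpace ℝ (Fin d)

/-- The unit cube `X = [0,1]^d`. -/
def cube (d : ℕ) : Set (Space d) := {x | ∀ l, x l ∈ Set.Icc (0 : ℝ) 1}

section Transport

variable {E F : Type*} [MeasurableSpace E] [MeasurableSpace F]

/-- `Π(μ, ν)`: the measures on the product with marginals `μ` and `ν`. -/
def couplings (μ : Measure E) (ν : Measure F) : Set (Measure (E × F)) :=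
  {π | π.fst = μ ∧ π.snd = ν}

/-- The Wasserstein-1 distance
`W(ρ, ρ') = inf {∫ |y - y'| dγ(y, y') : γ ∈ Π(ρ, ρ')}`
(it is `∞` when there is no coupling, that is, for different masses). -/
def wasserstein [PseudoEMetricSpace E] (ρ ρ' : Measure E) : ℝ≥0∞ :=
  ⨅ γ ∈ couplings ρ ρ', ∫⁻ z, edist z.1 z.2 ∂γ

/-- The vertical transport metric on `Π(μ)`,
`𝒲(π, π') = ∫ W(π_x, π'_x) dμ(x)`,
where `π = μ ⊗ π_x` and `π' = μ ⊗ π'_x` are the disintegrations with respect to the first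
marginal `μ`. Disintegrations are unique up to `μ`-null sets, so the infimum over all of them is
an infimum over a single value (see `verticalDist_eq`); it is `∞` unless `π` and `π'` both are
of the form `μ ⊗ π_x` with probability measures `π_x`. -/
def verticalDist [PseudoEMetricSpace F] (μ : Measure E) (π π' : Measure (E × F)) : ℝ≥0∞ :=
  ⨅ (κ : Kernel E F) (κ' : Kernel E F) (_ : IsMarkovKernel κ ∧ μ ⊗ₘ κ = π)
    (_ : IsMarkovKernel κ' ∧ μ ⊗ₘ κ' = π'), ∫⁻ x, wasserstein (κ x) (κ' x) ∂μ

theorem verticalDist_eq [PseudoEMetricSpace F] [MeasurableSpace.CountableOrCountablyGenerated E F]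
    (μ : Measure E) [IsFiniteMeasure μ] (κ κ' : Kernel E F)
    [IsMarkovKernel κ] [IsMarkovKernel κ'] :
    verticalDist μ (μ ⊗ₘ κ) (μ ⊗ₘ κ') = ∫⁻ x, wasserstein (κ x) (κ' x) ∂μ := by
  apply le_antisymm
  · exact iInf_le_of_le κ (iInf_le_of_le κ'
      (iInf_le_of_le ⟨inferInstance, rfl⟩ (iInf_le_of_le ⟨inferInstance, rfl⟩ le_rfl)))
  · refine le_iInf fun η => le_iInf fun η' => le_iInf fun h => le_iInf fun h' => ?_
    have := h.1
    have := h'.1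
    have e := Kernel.ae_eq_of_compProd_eq h.2
    have e' := Kernel.ae_eq_of_compProd_eq h'.2
    apply le_of_eq
    apply lintegral_congr_ae
    filter_upwards [e, e'] with x hx hx'
    rw [hx, hx']

/-- The objective `∫ c dπ + ε KL(π | μ ⊗ ν)` of (entropic) optimal transport. For `ε = 0` the
second term vanishes, also where the divergence is infinite. -/
def objective (c : E × F → ℝ) (ε : ℝ≥0) (μ : Measure E) (ν : Measure F)
    (π : Measure (E × F)) : EReal :=
  ((∫ z, c z ∂π : ℝ) : EReal)
    + (((ε : ℝ≥0∞) * InformationTheory.klDiv π (μ.prod ν) : ℝ≥0∞) : EReal)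

/-- `π` minimizes `∫ c dπ + ε KL(π | μ₁ ⊗ ν)` over `Π(μ₁, ν₁)`. -/
def IsCellSolution (c : E × F → ℝ) (ε : ℝ≥0) (ν : Measure F) (μ₁ : Measure E) (ν₁ : Measure F)
    (π : Measure (E × F)) : Prop :=
  π ∈ couplings μ₁ ν₁ ∧ ∀ π' ∈ couplings μ₁ ν₁, objective c ε μ₁ ν π ≤ objective c ε μ₁ ν π'

end Transport

section Variation

variable {d : ℕ}

/-- The divergence of a vector field. -/
def divergence (φ : Space d → Space d) (x : Space d) : ℝ :=
  ∑ l, (fderiv ℝ φ x (EuclideanSpace.single l 1)) l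

/-- The total variation of `u` on `ℝ^d`: the supremum of `∫ u div φ` over all `C¹` vector fields
`φ` of compact support with `|φ| ≤ 1`. Since `φ = 0` is allowed, negative values can be cut off. -/
def totalVariation (u : Space d → ℝ) : ℝ≥0∞ :=
  ⨆ (φ : Space d → Space d) (_ : ContDiff ℝ 1 φ) (_ : HasCompactSupport φ)
    (_ : ∀ x, ‖φ x‖ ≤ 1), ENNReal.ofReal (∫ x, u x * divergence φ x)

/-- The function `u ∈ L¹(ℝ^d)` is of bounded variation. -/
def IsBV (u : Space d → ℝ) : Prop :=
  Integrable u ∧ totalVariation u < ∞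

/-- The density `dμ/dℒ` on `ℝ^d`. -/
def density (μ : Measure (Space d)) (x : Space d) : ℝ := (μ.rnDeriv volume x).toReal

end Variation

section Cells

variable {d : ℕ}

/-- The index set `{0, …, n-1}^d` of the basic cells. -/
abbrev Index (d n : ℕ) := Fin d → Fin n

/-- The basic cell `i/n + [0,1/n]^d`. -/
def cell {n : ℕ} (i : Index d n) : Set (Space d) :=
  {x | ∀ l, x l ∈ Set.Icc (((i l : ℕ) : ℝ) / n) ((((i l : ℕ) : ℝ) + 1) / n)}

/-- The composite partition of the basic cells into blocks of `2^d` adjacent cells, shifted by `s`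
cells in every direction: two cells `i, j` belong to the same block when
`⌊(i_l + s)/2⌋ = ⌊(j_l + s)/2⌋` for all `l`. The partition `𝒥_A` has `s = 0`, and `𝒥_B` has
`s = 1`; the latter has smaller blocks at the boundary. -/
def compositePartition (d n s : ℕ) : Finset (Finset (Index d n)) :=
  Finset.univ.image fun i : Index d n =>
    Finset.univ.filter fun j => ∀ l, ((j l : ℕ) + s) / 2 = ((i l : ℕ) + s) / 2

/-- The partition of iteration `k`: `𝒥_A` for odd `k` and `𝒥_B` for even `k`. -/
def iterPartition (d n k : ℕ) : Finset (Finset (Index d n)) :=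
  if Odd k then compositePartition d n 0 else compositePartition d n 1

/-- `X_J`, the union of the basic cells in `J`. -/
def compositeCell {n : ℕ} (J : Finset (Index d n)) : Set (Space d) := ⋃ i ∈ J, cell i

/-- The partial second marginal `P_Y (π ⌞ (A × Y))`. -/
def partialMarginal (π : Measure (Space d × Space d)) (A : Set (Space d)) :
    Measure (Space d) :=
  (π.restrict (A ×ˢ Set.univ)).snd

/-- The normalized partial marginal `ρ_i = ν_i / m_i`, where `m_i = μ(X_i)`. -/
def cellMarginal (μ : Measure (Space d)) (π : Measure (Space d × Space d)) {n : ℕ}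
    (i : Index d n) : Measure (Space d) :=
  (μ (cell i))⁻¹ • partialMarginal π (cell i)

/-- The normalized partial marginal `ρ_J = ν_J / m_J`, where `m_J = ∑_{i ∈ J} m_i`. -/
def compositeMarginal (μ : Measure (Space d)) (π : Measure (Space d × Space d)) {n : ℕ}
    (J : Finset (Index d n)) : Measure (Space d) :=
  (∑ i ∈ J, μ (cell i))⁻¹ • partialMarginal π (compositeCell J)

/-- `WTVB(π) = n^{-(d-1)} ∑ W(ρ_i, ρ_{i'})`, where the sum runs over all pairs of basic cells with
`i - i' ∈ {2e_1, …, 2e_d}`. -/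
def WTVB (μ : Measure (Space d)) (n : ℕ) (π : Measure (Space d × Space d)) : ℝ≥0∞ :=
  ((n : ℝ≥0∞) ^ (d - 1))⁻¹ *
    ∑ p : Index d n × Index d n with
        ∃ l, ∀ m, (p.1 m : ℕ) = (p.2 m : ℕ) + (if m = l then 2 else 0),
      wasserstein (cellMarginal μ π p.1) (cellMarginal μ π p.2)

end Cells

section Algorithm

variable {d : ℕ}

/-- The data of the discrete problem at one discretization level. -/
structure LevelData (d : ℕ) where
  /-- the first marginal `μ^n` -/
  margX : Measure (Space d)
  /-- the second marginal `ν^n` -/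
  margY : Measure (Space d)
  /-- the initial coupling -/
  init : Measure (Space d × Space d)
  /-- the cost function `c^n` -/
  cost : Space d × Space d → ℝ
  /-- the regularization parameter `ε^n` -/
  eps : ℝ≥0

/-- The standing assumptions on the data at level `n`: `μ^n ∈ 𝒫(X)` gives every basic cell the
mass that it has under `μ` and gives no mass to the boundaries of the basic cells,
`ν^n ∈ 𝒫(Y)`, the initial coupling lies in `Π(μ^n, ν^n)`, and the cost is measurable and bounded
on `X × Y`. -/
structure LevelData.IsAdmissible (P : LevelData d) (Y : Set (Space d)) (μ : Measure (Space d))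
    (n : ℕ) : Prop where
  margX_prob : IsProbabilityMeasure P.margX
  margX_cube : P.margX (cube d)ᶜ = 0
  margX_cell : ∀ i : Index d n, P.margX (cell i) = μ (cell i)
  margX_frontier : ∀ i : Index d n, P.margX (frontier (cell i)) = 0
  margY_prob : IsProbabilityMeasure P.margY
  margY_Y : P.margY Yᶜ = 0
  init_mem : P.init ∈ couplings P.margX P.margY
  cost_meas : Measurable P.cost
  cost_bdd : ∃ B : ℝ, ∀ x ∈ cube d, ∀ y ∈ Y, |P.cost (x, y)| ≤ B

/-- `π 0, π 1, …` are iterates of the domain decomposition algorithm at level `n`: starting from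
the initial coupling, in iteration `k + 1` each cell `J` of the current composite partition is
equipped with a solution of the cell problem with marginals `μ^n ⌞ X_J` and
`P_Y (π k ⌞ (X_J × Y))`, and `π (k + 1)` is the sum of these solutions. -/
def IsIterates (n : ℕ) (P : LevelData d) (π : ℕ → Measure (Space d × Space d)) : Prop :=
  π 0 = P.init ∧
  ∀ k, ∃ σ : Finset (Index d n) → Measure (Space d × Space d),
    (∀ J ∈ iterPartition d n (k + 1),
      IsCellSolution P.cost P.eps P.margY (P.margX.restrict (compositeCell J))
        (partialMarginal (π k) (compositeCell J)) (σ J)) ∧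
    π (k + 1) = ∑ J ∈ iterPartition d n (k + 1), σ J

/-- The discrete trajectory at time `t`: with `k = ⌊n t⌋`, the measure on `X × Y` with first
marginal `μ` whose disintegration at `x ∈ X_J` is `ρ_J`, for each cell `J` of the partition of
iteration `k`. (The cells overlap in null sets only.) -/
def trajectory (μ : Measure (Space d)) (n : ℕ) (π : ℕ → Measure (Space d × Space d)) (t : ℝ) :
    Measure (Space d × Space d) :=
  ∑ J ∈ iterPartition d n ⌊(n : ℝ) * t⌋₊,
    (μ.restrict (compositeCell J)).prod (compositeMarginal μ (π ⌊(n : ℝ) * t⌋₊) J)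

end Algorithm

end DomDec

end

/-! An iteration only redistributes mass inside the blocks of its own partition, and the
second-marginal constraint of each cell problem fixes `P_Y` over every such block. Hence the
trajectory at time `(k+1)/n` already has the fibres `ρ_J` of `π k`, only averaged over the blocks of
the other partition. The distance of two successive times is therefore the sum over basic cells `i`
of `μ(X_i)` times the distance between the averages of `π k` over the A-block and the B-block of `i`
(`verticalDist_trajectory_eq`).

For a cell `i` away from the boundary both blocks have `2^d` cells, indexed by the sets `S` of
directions in which `i` is replaced by its neighbour in the block. Equal `S` matches the cells of
the two blocks, and matched cells differ by `±2` in each direction of `S` and agree in the others.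

The distance of the two averages has two sources. Matched cells carry different `ρ`: changing one
direction at a time gives at most `d` steps, each a pair counted by `WTVB`, and for fixed `S` and
fixed direction a pair is used at most once for each of two parities (`sum_reflect_le`). This gives
`C = 2^d * 2d`. Moreover the weights differ: the unmatched mass travels at most `diam Y` and is
bounded by the differences of cell masses divided by `2^d M_l n^{-d}` (`wasserstein_normalized_le`).
For fixed `S` and fixed parities of the coordinates these are differences of the density under one
translation of length at most `2√d/n`, so total variation controls their sum
(`ofReal_sum_abs_setIntegral_sub_le`).

At most `2d n^{d-1}` cells touch the boundary, each contributing at most `diam Y`. Multiplying by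
`μ(X_i) ≤ M_u n^{-d}` leaves the factor `M_u/n`. -/

namespace DomDec

/-! ### Calculus of the Wasserstein distance for measures of arbitrary mass. -/

section Wasserstein

variable {E : Type*} [MeasurableSpace E] [PseudoEMetricSpace E]

theorem wasserstein_le_of_coupling {ρ ρ' : Measure E} {γ : Measure (E × E)}
    (hγ : γ ∈ couplings ρ ρ') : wasserstein ρ ρ' ≤ ∫⁻ z, edist z.1 z.2 ∂γ :=
  iInf₂_le γ hγ

variable [OpensMeasurableSpace E] [SecondCountableTopology E]

omit [PseudoEMetricSpace E] [OpensMeasurableSpace E] [SecondCountableTopology E] in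
theorem swap_mem_couplings {ρ ρ' : Measure E} {γ : Measure (E × E)}
    (hγ : γ ∈ couplings ρ ρ') : γ.map Prod.swap ∈ couplings ρ' ρ := by
  constructor
  · rw [← hγ.2, Measure.fst, Measure.snd, Measure.map_map measurable_fst measurable_swap]
    rfl
  · rw [← hγ.1, Measure.fst, Measure.snd, Measure.map_map measurable_snd measurable_swap]
    rfl

theorem wasserstein_comm (ρ ρ' : Measure E) : wasserstein ρ ρ' = wasserstein ρ' ρ := by
  have key : ∀ ρ ρ' : Measure E, wasserstein ρ ρ' ≤ wasserstein ρ' ρ := by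
    intro ρ ρ'
    refine le_iInf₂ fun γ hγ => (wasserstein_le_of_coupling (swap_mem_couplings hγ)).trans ?_
    rw [lintegral_map (by fun_prop) measurable_swap]
    simp [edist_comm]
  exact le_antisymm (key _ _) (key _ _)

theorem wasserstein_self (ρ : Measure E) : wasserstein ρ ρ = 0 := by
  have hm : Measurable fun x : E => (x, x) := by fun_prop
  have hγ : ρ.map (fun x => (x, x)) ∈ couplings ρ ρ := by
    constructor
    · rw [Measure.fst, Measure.map_map measurable_fst hm]
      exact Measure.map_id
    · rw [Measure.snd, Measure.map_map measurable_snd hm]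
      exact Measure.map_id
  refine le_antisymm ((wasserstein_le_of_coupling hγ).trans ?_) zero_le
  rw [lintegral_map (by fun_prop) hm]
  simp

omit [OpensMeasurableSpace E] [SecondCountableTopology E] in
theorem wasserstein_add_le (α α' β β' : Measure E) :
    wasserstein (α + α') (β + β') ≤ wasserstein α β + wasserstein α' β' := by
  unfold wasserstein
  rw [ENNReal.iInf_add]
  refine le_iInf fun γ => ?_
  rw [ENNReal.iInf_add]
  refine le_iInf fun hγ => ?_
  rw [ENNReal.add_iInf]
  refine le_iInf fun γ' => ?_
  rw [ENNReal.add_iInf]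
  refine le_iInf fun hγ' => ?_
  refine (wasserstein_le_of_coupling (γ := γ + γ') ⟨?_, ?_⟩).trans ?_
  · rw [← hγ.1, ← hγ'.1, Measure.fst, Measure.map_add _ _ measurable_fst]; rfl
  · rw [← hγ.2, ← hγ'.2, Measure.snd, Measure.map_add _ _ measurable_snd]; rfl
  · rw [lintegral_add_measure]

theorem wasserstein_smul_le (a : ℝ≥0) (ρ ρ' : Measure E) :
    wasserstein (a • ρ) (a • ρ') ≤ a * wasserstein ρ ρ' := by
  -- For `a = 0` the factor cannot be moved into the infimum, but both measures vanish.
  rcases eq_or_ne a 0 with rfl | ha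
  · simp [wasserstein_self]
  unfold wasserstein
  rw [ENNReal.mul_iInf_of_ne (by simpa using ha) ENNReal.coe_ne_top]
  refine le_iInf fun γ => ?_
  rw [ENNReal.mul_iInf_of_ne (by simpa using ha) ENNReal.coe_ne_top]
  refine le_iInf fun hγ => ?_
  refine (wasserstein_le_of_coupling (γ := a • γ) ⟨?_, ?_⟩).trans ?_
  · rw [← hγ.1, Measure.fst, Measure.map_smul]; rfl
  · rw [← hγ.2, Measure.snd, Measure.map_smul]; rfl
  · rw [lintegral_smul_measure]; rfl

theorem wasserstein_sum_le {ι : Type*} (s : Finset ι) (a : ι → ℝ≥0) (ρ ρ' : ι → Measure E) :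
    wasserstein (∑ j ∈ s, a j • ρ j) (∑ j ∈ s, a j • ρ' j)
      ≤ ∑ j ∈ s, a j * wasserstein (ρ j) (ρ' j) := by
  classical
  induction s using Finset.induction_on with
  | empty => simp [wasserstein_self]
  | insert j s hj ih =>
    rw [Finset.sum_insert hj, Finset.sum_insert hj, Finset.sum_insert hj]
    exact (wasserstein_add_le _ _ _ _).trans (add_le_add (wasserstein_smul_le _ _ _) ih)

/-- Measures of equal mass that are concentrated on `Y` are at distance at most `diam Y` times
their mass. -/
theorem wasserstein_le_ediam_mul {Y : Set E} {α β : Measure E} [IsFiniteMeasure α]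
    [IsFiniteMeasure β] (hα : α Yᶜ = 0) (hβ : β Yᶜ = 0) (h : α Set.univ = β Set.univ) :
    wasserstein α β ≤ Metric.ediam Y * α Set.univ := by
  -- Otherwise the normalized product measure is a coupling; for mass zero its normalization would
  -- be infinite.
  rcases eq_or_ne (α Set.univ) 0 with h0 | h0
  · have h1 : β Set.univ = 0 := h ▸ h0
    rw [Measure.measure_univ_eq_zero.1 h0, Measure.measure_univ_eq_zero.1 h1, wasserstein_self]
    exact zero_le
  have ht := measure_ne_top α Set.univ
  have hγ : (α Set.univ)⁻¹ • α.prod β ∈ couplings α β := by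
    constructor
    · rw [Measure.fst, Measure.map_smul]
      rw [Measure.map_fst_prod, smul_smul, ← h, ENNReal.inv_mul_cancel h0 ht, one_smul]
    · rw [Measure.snd, Measure.map_smul]
      rw [Measure.map_snd_prod, smul_smul, ENNReal.inv_mul_cancel h0 ht, one_smul]
  refine (wasserstein_le_of_coupling hγ).trans ?_
  rw [lintegral_smul_measure, smul_eq_mul]
  have hb : ∀ᵐ z ∂(α.prod β), edist z.1 z.2 ≤ Metric.ediam Y := by
    have h1 : ∀ᵐ z ∂(α.prod β), z.1 ∈ Y := Measure.quasiMeasurePreserving_fst.ae hα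
    have h2 : ∀ᵐ z ∂(α.prod β), z.2 ∈ Y := Measure.quasiMeasurePreserving_snd.ae hβ
    filter_upwards [h1, h2] with z hz1 hz2 using Metric.edist_le_ediam_of_mem hz1 hz2
  calc (α Set.univ)⁻¹ * ∫⁻ z, edist z.1 z.2 ∂(α.prod β)
      ≤ (α Set.univ)⁻¹ * ∫⁻ _, Metric.ediam Y ∂(α.prod β) := by
        exact mul_le_mul_right (lintegral_mono_ae hb) _
    _ = Metric.ediam Y * α Set.univ * ((α Set.univ)⁻¹ * α Set.univ) := by
        rw [lintegral_const, ← Set.univ_prod_univ, Measure.prod_prod, ← h]; ring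
    _ = _ := by rw [ENNReal.inv_mul_cancel h0 ht, mul_one]

omit [PseudoEMetricSpace E] [OpensMeasurableSpace E] [SecondCountableTopology E] in
-- The two outer points are drawn independently, conditionally on the middle one. The middle point
-- is the first coordinate of `Θ`, which is why `γ` is swapped before it is disintegrated.
theorem exists_gluing [StandardBorelSpace E] [Nonempty E] {ρ₁ ρ₂ ρ₃ : Measure E}
    {γ γ' : Measure (E × E)} [IsFiniteMeasure γ] [IsFiniteMeasure γ']
    (hγ : γ ∈ couplings ρ₁ ρ₂) (hγ' : γ' ∈ couplings ρ₂ ρ₃) :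
    ∃ Θ : Measure (E × E × E), Θ.map (fun z => (z.2.1, z.1)) = γ ∧
      Θ.map (fun z => (z.1, z.2.2)) = γ' := by
  have hfst : (γ.map Prod.swap).fst = ρ₂ := by
    rw [← hγ.2, Measure.fst, Measure.map_map measurable_fst measurable_swap]; rfl
  have : IsFiniteMeasure ρ₂ := hfst ▸ inferInstance
  have h1 : ρ₂ ⊗ₘ (γ.map Prod.swap).condKernel = γ.map Prod.swap := by
    conv_rhs => rw [← (γ.map Prod.swap).disintegrate (γ.map Prod.swap).condKernel, hfst]
  have h2 : ρ₂ ⊗ₘ γ'.condKernel = γ' := by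
    conv_rhs => rw [← γ'.disintegrate γ'.condKernel, hγ'.1]
  refine ⟨ρ₂ ⊗ₘ ((γ.map Prod.swap).condKernel ×ₖ γ'.condKernel), ?_, ?_⟩
  · refine Measure.ext_of_lintegral _ fun f hf => ?_
    rw [lintegral_map hf (by fun_prop), Measure.lintegral_compProd (by fun_prop)]
    have h3 : ∫⁻ z, f z ∂γ = ∫⁻ z, f z.swap ∂(γ.map Prod.swap) := by
      rw [lintegral_map (by fun_prop) measurable_swap]; simp
    conv_rhs => rw [h3, ← h1, Measure.lintegral_compProd (by fun_prop)]
    refine lintegral_congr fun y => ?_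
    rw [Kernel.prod_apply, lintegral_prod _ (by fun_prop)]
    simp
  · refine Measure.ext_of_lintegral _ fun f hf => ?_
    rw [lintegral_map hf (by fun_prop), Measure.lintegral_compProd (by fun_prop)]
    conv_rhs => rw [← h2, Measure.lintegral_compProd (by fun_prop)]
    refine lintegral_congr fun y => ?_
    rw [Kernel.prod_apply, lintegral_prod _ (by fun_prop)]
    simp

theorem wasserstein_triangle [StandardBorelSpace E] (ρ₁ ρ₂ ρ₃ : Measure E)
    [IsFiniteMeasure ρ₁] [IsFiniteMeasure ρ₂] :
    wasserstein ρ₁ ρ₃ ≤ wasserstein ρ₁ ρ₂ + wasserstein ρ₂ ρ₃ := by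
  -- Disintegration requires a nonempty space.
  rcases isEmpty_or_nonempty E with hE | hE
  · rw [Subsingleton.elim ρ₃ ρ₁, wasserstein_self]; exact zero_le
  conv_rhs => unfold wasserstein
  rw [ENNReal.iInf_add]
  refine le_iInf fun γ => ?_
  rw [ENNReal.iInf_add]
  refine le_iInf fun hγ => ?_
  rw [ENNReal.add_iInf]
  refine le_iInf fun γ' => ?_
  rw [ENNReal.add_iInf]
  refine le_iInf fun hγ' => ?_
  have : IsFiniteMeasure γ := ⟨by
    rw [← Measure.fst_univ, hγ.1]; exact measure_lt_top _ _⟩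
  have : IsFiniteMeasure γ' := ⟨by
    rw [← Measure.fst_univ, hγ'.1]; exact measure_lt_top _ _⟩
  obtain ⟨Θ, h1, h2⟩ := exists_gluing hγ hγ'
  have hm1 : Measurable fun z : E × E × E => (z.2.1, z.1) := by fun_prop
  have hm2 : Measurable fun z : E × E × E => (z.1, z.2.2) := by fun_prop
  have hc : Θ.snd ∈ couplings ρ₁ ρ₃ := by
    constructor
    · rw [← hγ.1, ← h1, Measure.fst, Measure.fst, Measure.snd,
        Measure.map_map measurable_fst measurable_snd, Measure.map_map measurable_fst hm1]
      rfl
    · rw [← hγ'.2, ← h2, Measure.snd, Measure.snd, Measure.snd,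
        Measure.map_map measurable_snd measurable_snd, Measure.map_map measurable_snd hm2]
      rfl
  refine (wasserstein_le_of_coupling hc).trans ?_
  have he : Measurable fun z : E × E => edist z.1 z.2 := by fun_prop
  rw [← h1, ← h2, Measure.snd, lintegral_map he measurable_snd, lintegral_map he hm1,
    lintegral_map he hm2, ← lintegral_add_left (by fun_prop)]
  exact lintegral_mono fun z => edist_triangle _ _ _

/-- If two measures on `Y` have the common part `∑ a j • ρ j`, `∑ a j • ρ' j`, up to a transport
of the `ρ j` to the `ρ' j`, then their distance is controlled by that transport and by the
remaining mass. -/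
theorem wasserstein_weighted_le {ι : Type*} (s : Finset ι) {Y : Set E} (a w w' : ι → ℝ≥0)
    (ρ ρ' : ι → Measure E) [∀ j, IsProbabilityMeasure (ρ j)]
    [∀ j, IsProbabilityMeasure (ρ' j)] (hρ : ∀ j, ρ j Yᶜ = 0) (hρ' : ∀ j, ρ' j Yᶜ = 0)
    (haw : ∀ j ∈ s, a j ≤ w j) (haw' : ∀ j ∈ s, a j ≤ w' j)
    (hw : ∑ j ∈ s, w j = 1) (hw' : ∑ j ∈ s, w' j = 1) :
    wasserstein (∑ j ∈ s, w j • ρ j) (∑ j ∈ s, w' j • ρ' j)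
      ≤ ∑ j ∈ s, a j * wasserstein (ρ j) (ρ' j)
        + Metric.ediam Y * ((1 - ∑ j ∈ s, a j : ℝ≥0) : ℝ≥0∞) := by
  -- The common part is transported index by index; both remainders have mass `1 - ∑ a j` and are
  -- coupled arbitrarily inside `Y`.
  have split : ∀ (v : ι → ℝ≥0) (η : ι → Measure E), (∀ j ∈ s, a j ≤ v j) →
      ∑ j ∈ s, v j • η j = ∑ j ∈ s, a j • η j + ∑ j ∈ s, (v j - a j) • η j := by
    intro v η hv
    rw [← Finset.sum_add_distrib]
    refine Finset.sum_congr rfl fun j hj => ?_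
    rw [← add_smul, add_tsub_cancel_of_le (hv j hj)]
  have mass : ∀ (v : ι → ℝ≥0) (η : ι → Measure E), (∀ j, IsProbabilityMeasure (η j)) →
      (∀ j ∈ s, a j ≤ v j) → ∑ j ∈ s, v j = 1 →
      (∑ j ∈ s, (v j - a j) • η j) Set.univ = ((1 - ∑ j ∈ s, a j : ℝ≥0) : ℝ≥0∞) := by
    intro v η hη hv h1
    rw [Measure.finsetSum_apply]
    have : ∀ j ∈ s, ((v j - a j) • η j) Set.univ = ((v j - a j : ℝ≥0) : ℝ≥0∞) := by
      intro j _
      simp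
    rw [Finset.sum_congr rfl this, ← ENNReal.ofNNReal_finsetSum, ENNReal.coe_inj, ← h1]
    refine eq_tsub_of_add_eq ?_
    rw [← Finset.sum_add_distrib]
    exact Finset.sum_congr rfl fun j hj => tsub_add_cancel_of_le (hv j hj)
  have conc : ∀ (v : ι → ℝ≥0) (η : ι → Measure E), (∀ j, η j Yᶜ = 0) →
      (∑ j ∈ s, (v j - a j) • η j) Yᶜ = 0 := by
    intro v η hη
    rw [Measure.finsetSum_apply]
    refine Finset.sum_eq_zero fun j _ => ?_
    simp [hη j]
  have fin : ∀ (v : ι → ℝ≥0) (η : ι → Measure E), (∀ j, IsProbabilityMeasure (η j)) →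
      (∀ j ∈ s, a j ≤ v j) → ∑ j ∈ s, v j = 1 →
      IsFiniteMeasure (∑ j ∈ s, (v j - a j) • η j) := fun v η h1 h2 h3 =>
    ⟨by rw [mass v η h1 h2 h3]; exact ENNReal.coe_lt_top⟩
  have := fin w ρ inferInstance haw hw
  have := fin w' ρ' inferInstance haw' hw'
  rw [split w ρ haw, split w' ρ' haw', ← mass w ρ inferInstance haw hw]
  refine (wasserstein_add_le _ _ _ _).trans (add_le_add (wasserstein_sum_le _ _ _ _) ?_)
  refine wasserstein_le_ediam_mul (conc w ρ hρ) (conc w' ρ' hρ') ?_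
  rw [mass w ρ inferInstance haw hw, mass w' ρ' inferInstance haw' hw']

end Wasserstein

/-! ### Functions of bounded variation under translation. -/

section Variation

variable {d : ℕ}

/-- The average of `ψ` over the segment from `x - h` to `x`. -/
noncomputable def segmentAverage (ψ : Space d → ℝ) (h x : Space d) : ℝ :=
  ∫ t in (0 : ℝ)..1, ψ (x - t • h)

theorem hasFDerivAt_segmentAverage {ψ : Space d → ℝ} (hψ : ContDiff ℝ 1 ψ)
    (hc : HasCompactSupport ψ) (h x : Space d) :
    HasFDerivAt (segmentAverage ψ h) (∫ t in (0 : ℝ)..1, fderiv ℝ ψ (x - t • h)) x := by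
  have hd : Continuous (fderiv ℝ ψ) := hψ.continuous_fderiv one_ne_zero
  obtain ⟨B, hB⟩ := hd.bounded_above_of_compact_support (hc.fderiv (𝕜 := ℝ))
  have hψc := hψ.continuous
  refine intervalIntegral.hasFDerivAt_integral_of_dominated_of_fderiv_le (s := Set.univ)
    (F := fun x t => ψ (x - t • h)) (F' := fun x t => fderiv ℝ ψ (x - t • h))
    (bound := fun _ => B) Filter.univ_mem ?_ ?_ ?_ ?_ ?_ ?_
  · exact Filter.Eventually.of_forall fun y =>
      (by fun_prop : Continuous fun t : ℝ => ψ (y - t • h)).aestronglyMeasurable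
  · exact (by fun_prop : Continuous fun t : ℝ => ψ (x - t • h)).intervalIntegrable _ _
  · exact (by fun_prop : Continuous fun t : ℝ => fderiv ℝ ψ (x - t • h)).aestronglyMeasurable
  · exact Filter.Eventually.of_forall fun t _ y _ => hB _
  · exact continuous_const.intervalIntegrable _ _
  · refine Filter.Eventually.of_forall fun t _ y _ => ?_
    have h1 := ((hψ.differentiable one_ne_zero) (y - t • h)).hasFDerivAt
    exact h1.comp y ((hasFDerivAt_id y).sub_const (t • h))

theorem contDiff_segmentAverage {ψ : Space d → ℝ} (hψ : ContDiff ℝ 1 ψ)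
    (hc : HasCompactSupport ψ) (h : Space d) : ContDiff ℝ 1 (segmentAverage ψ h) := by
  have hd : Continuous (fderiv ℝ ψ) := hψ.continuous_fderiv one_ne_zero
  rw [contDiff_one_iff_fderiv]
  refine ⟨fun x => (hasFDerivAt_segmentAverage hψ hc h x).differentiableAt, ?_⟩
  have : fderiv ℝ (segmentAverage ψ h)
      = fun x => ∫ t in (0 : ℝ)..1, fderiv ℝ ψ (x - t • h) :=
    funext fun x => (hasFDerivAt_segmentAverage hψ hc h x).fderiv
  rw [this]
  refine intervalIntegral.continuous_parametric_intervalIntegral_of_continuous' ?_ 0 1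
  exact (by fun_prop : Continuous fun p : Space d × ℝ => fderiv ℝ ψ (p.1 - p.2 • h))

theorem hasCompactSupport_segmentAverage {ψ : Space d → ℝ} (hc : HasCompactSupport ψ)
    (h : Space d) : HasCompactSupport (segmentAverage ψ h) := by
  have hK : IsCompact ((fun p : Space d × ℝ => p.1 + p.2 • h) ''
      (tsupport ψ ×ˢ Set.Icc (0 : ℝ) 1)) :=
    (IsCompact.prod hc isCompact_Icc).image (by fun_prop)
  refine HasCompactSupport.intro hK fun x hx => ?_
  unfold segmentAverage
  refine (intervalIntegral.integral_congr (g := fun _ => (0 : ℝ)) fun t ht => ?_).trans (by simp)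
  rw [Set.uIcc_of_le zero_le_one] at ht
  by_contra hne
  exact hx ⟨(x - t • h, t), ⟨subset_tsupport _ hne, ht⟩, by simp⟩

theorem integral_fderiv_segment {ψ : Space d → ℝ} (hψ : ContDiff ℝ 1 ψ) (h x : Space d) :
    ∫ t in (0 : ℝ)..1, fderiv ℝ ψ (x - t • h) h = ψ x - ψ (x - h) := by
  have hd : Continuous (fderiv ℝ ψ) := hψ.continuous_fderiv one_ne_zero
  have hder : ∀ t : ℝ, HasDerivAt (fun t : ℝ => - ψ (x - t • h)) (fderiv ℝ ψ (x - t • h) h) t := by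
    intro t
    have h1 := ((hψ.differentiable one_ne_zero) (x - t • h)).hasFDerivAt
    have h2 : HasDerivAt (fun t : ℝ => x - t • h) (-h) t := by
      simpa using ((hasDerivAt_id t).smul_const h).const_sub x
    have h3 := (h1.comp_hasDerivAt t h2).neg
    rw [map_neg, neg_neg] at h3
    exact h3
  rw [intervalIntegral.integral_eq_sub_of_hasDerivAt (fun t _ => hder t)]
  · simp; ring
  · exact (by fun_prop :
      Continuous fun t : ℝ => fderiv ℝ ψ (x - t • h) h).intervalIntegrable _ _

/-- The divergence of a scalar function times the constant vector `h` is its derivative along `h`,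
and averaging that derivative over the segment gives the difference of the end values. Finite
differences thus become admissible divergences in `totalVariation`. -/
theorem divergence_segmentAverage_smul {ψ : Space d → ℝ} (hψ : ContDiff ℝ 1 ψ)
    (hc : HasCompactSupport ψ) (h x : Space d) (r : ℝ) :
    divergence (fun y => (r * segmentAverage ψ h y) • h) x = r * (ψ x - ψ (x - h)) := by
  have hd : Continuous (fderiv ℝ ψ) := hψ.continuous_fderiv one_ne_zero
  have h1 := ((hasFDerivAt_segmentAverage hψ hc h x).const_mul r).smul_const h
  unfold divergence
  rw [h1.fderiv]
  set D := ∫ t in (0 : ℝ)..1, fderiv ℝ ψ (x - t • h) with hD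
  have h2 : D h = ψ x - ψ (x - h) := by
    rw [← integral_fderiv_segment hψ h x, hD, ContinuousLinearMap.intervalIntegral_apply]
    exact (by fun_prop : Continuous fun t : ℝ => fderiv ℝ ψ (x - t • h)).intervalIntegrable _ _
  have h3 : h = ∑ l, h l • EuclideanSpace.single l (1 : ℝ) := by
    simpa using ((EuclideanSpace.basisFun (Fin d) ℝ).sum_repr h).symm
  rw [← h2]
  conv_rhs => rw [h3]
  simp only [map_sum, map_smul, Finset.mul_sum]
  refine Finset.sum_congr rfl fun l _ => ?_
  simp
  ring

theorem ofReal_integral_mul_sub_le (u : Space d → ℝ) {ψ : Space d → ℝ} (hψ : ContDiff ℝ 1 ψ)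
    (hc : HasCompactSupport ψ) (hb : ∀ x, |ψ x| ≤ 1) (h : Space d) :
    ENNReal.ofReal (∫ x, u x * (ψ x - ψ (x - h)))
      ≤ ENNReal.ofReal ‖h‖ * totalVariation u := by
  rcases eq_or_ne h 0 with rfl | hh
  · simp
  have hn : 0 < ‖h‖ := norm_pos_iff.2 hh
  -- The factor `‖h‖⁻¹` normalizes the field to length at most one and reappears as `‖h‖` in the
  -- bound.
  set φ : Space d → Space d := fun y => (‖h‖⁻¹ * segmentAverage ψ h y) • h with hφ
  have hφ1 : ContDiff ℝ 1 φ :=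
    (contDiff_const.mul (contDiff_segmentAverage hψ hc h)).smul contDiff_const
  have hφc : HasCompactSupport φ :=
    ((hasCompactSupport_segmentAverage hc h).mul_left).smul_right
  have hφb : ∀ x, ‖φ x‖ ≤ 1 := by
    intro x
    have : ‖segmentAverage ψ h x‖ ≤ 1 := by
      refine (intervalIntegral.norm_integral_le_of_norm_le_const (C := 1) fun t _ => ?_).trans
        (by simp)
      exact hb _
    rw [hφ, norm_smul, norm_mul, norm_inv, norm_norm]
    calc ‖h‖⁻¹ * ‖segmentAverage ψ h x‖ * ‖h‖ = ‖segmentAverage ψ h x‖ := by field_simp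
      _ ≤ 1 := this
  have heq : ∫ x, u x * (ψ x - ψ (x - h)) = ‖h‖ * ∫ x, u x * divergence φ x := by
    rw [← integral_const_mul]
    refine integral_congr_ae (Filter.Eventually.of_forall fun x => ?_)
    simp only [hφ, divergence_segmentAverage_smul hψ hc h x]
    field_simp
  rw [heq, ENNReal.ofReal_mul hn.le]
  refine mul_le_mul_right ?_ _
  exact le_iSup_of_le φ (le_iSup_of_le hφ1 (le_iSup_of_le hφc (le_iSup_of_le hφb le_rfl)))

/-- A function of bounded variation changes little under translations: its averages over
disjoint open sets and over their translates by `h` differ by at most `|h| TV(u)` in total. -/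
theorem ofReal_sum_abs_setIntegral_sub_le {ι : Type*} (T : Finset ι) (U : ι → Set (Space d))
    (hU : ∀ j, IsOpen (U j)) (hUb : ∀ j, Bornology.IsBounded (U j))
    (hdisj : Pairwise (Function.onFun Disjoint U)) {u : Space d → ℝ} (hu : Integrable u)
    (h : Space d) :
    ENNReal.ofReal (∑ j ∈ T, |(∫ x in U j, u x) - ∫ x in U j, u (x + h)|)
      ≤ ENNReal.ofReal ‖h‖ * totalVariation u := by
  classical
  set s : ι → ℝ := fun j => if 0 ≤ (∫ x in U j, u x) - ∫ x in U j, u (x + h) then 1 else -1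
    with hs
  have hs1 : ∀ j, |s j| = 1 := by intro j; simp only [hs]; split_ifs <;> simp
  have hsa : ∀ j, |(∫ x in U j, u x) - ∫ x in U j, u (x + h)|
      = s j * ((∫ x in U j, u x) - ∫ x in U j, u (x + h)) := by
    intro j
    simp only [hs]
    split_ifs with h0
    · rw [abs_of_nonneg h0, one_mul]
    · rw [abs_of_neg (not_le.1 h0), neg_one_mul]
  -- The optimal test function `G` takes the sign `s j` on `U j`. Since `f j` is positive exactly on
  -- `U j`, the smooth functions `g m` vanish off the `U j` and converge pointwise to `G`;
  -- disjointness keeps them bounded by one.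
  choose f hfs hfd hfr using fun j => (hU j).exists_contDiff_support_eq (n := 1)
  set g : ℕ → Space d → ℝ := fun m x => ∑ j ∈ T, s j * Real.smoothTransition (m * f j x) with hg
  set G : Space d → ℝ := fun x => ∑ j ∈ T, s j * (U j).indicator 1 x with hG
  have hzero : ∀ j x (m : ℕ), x ∉ U j → Real.smoothTransition (m * f j x) = 0 := by
    intro j x m hx
    rw [← hfs j, Function.notMem_support] at hx
    rw [hx, mul_zero, Real.smoothTransition.zero]
  have hgd : ∀ m, ContDiff ℝ 1 (g m) := fun m =>
    ContDiff.sum fun j _ => contDiff_const.mul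
      (Real.smoothTransition.contDiff.comp (contDiff_const.mul (hfd j)))
  have hgc : ∀ m, HasCompactSupport (g m) := by
    intro m
    have hK : IsCompact (⋃ j ∈ T, closure (U j)) :=
      T.isCompact_biUnion fun j _ => (hUb j).isCompact_closure
    refine HasCompactSupport.intro hK fun x hx => Finset.sum_eq_zero fun j hj => ?_
    rw [hzero j x m fun hxj => hx (Set.mem_biUnion hj (subset_closure hxj)), mul_zero]
  have hgb : ∀ m x, |g m x| ≤ 1 := by
    intro m x
    by_cases hx : ∃ j ∈ T, x ∈ U j
    · obtain ⟨j, hj, hxj⟩ := hx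
      have : g m x = s j * Real.smoothTransition (m * f j x) := by
        refine Finset.sum_eq_single j (fun i _ hij => ?_) (fun hj' => absurd hj hj')
        rw [hzero i x m fun hxi => Set.disjoint_left.1 (hdisj hij) hxi hxj, mul_zero]
      rw [this, abs_mul, hs1, one_mul, abs_of_nonneg (Real.smoothTransition.nonneg _)]
      exact Real.smoothTransition.le_one _
    · have : g m x = 0 := Finset.sum_eq_zero fun j hj => by
        rw [hzero j x m fun hxj => hx ⟨j, hj, hxj⟩, mul_zero]
      rw [this]; simp
  have hlim : ∀ x, Filter.Tendsto (fun m => g m x) Filter.atTop (nhds (G x)) := by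
    intro x
    refine tendsto_finsetSum _ fun j _ => Filter.Tendsto.const_mul _ ?_
    by_cases hx : x ∈ U j
    · rw [Set.indicator_of_mem hx]
      have hne : f j x ≠ 0 := by rw [← Function.mem_support, hfs]; exact hx
      have hpos : 0 < f j x :=
        lt_of_le_of_ne (hfr j (Set.mem_range_self x)).1 hne.symm
      refine tendsto_const_nhds.congr' ?_
      obtain ⟨N, hN⟩ := exists_nat_ge (f j x)⁻¹
      filter_upwards [Filter.eventually_ge_atTop N] with m hm
      have : (f j x)⁻¹ ≤ m := hN.trans (by exact_mod_cast hm)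
      rw [Real.smoothTransition.one_of_one_le]
      · rfl
      · calc (1 : ℝ) = (f j x)⁻¹ * f j x := (inv_mul_cancel₀ hne).symm
          _ ≤ m * f j x := by gcongr
    · rw [Set.indicator_of_notMem hx]
      exact tendsto_const_nhds.congr fun m => (hzero j x m hx).symm
  have hval : ∀ v : Space d → ℝ, Integrable v →
      Integrable (fun x => v x * G x) ∧ ∫ x, v x * G x = ∑ j ∈ T, s j * ∫ x in U j, v x := by
    intro v hv
    have h1 : (fun x => v x * G x) = fun x => ∑ j ∈ T, s j * (U j).indicator v x := by
      funext x
      rw [hG, Finset.mul_sum]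
      refine Finset.sum_congr rfl fun j _ => ?_
      by_cases hx : x ∈ U j
      · simp [hx]; ring
      · simp [hx]
    have h2 : ∀ j ∈ T, Integrable fun x => s j * (U j).indicator v x := fun j _ =>
      (hv.indicator (hU j).measurableSet).const_mul _
    rw [h1]
    refine ⟨integrable_finsetSum _ h2, ?_⟩
    rw [integral_finsetSum _ h2]
    refine Finset.sum_congr rfl fun j _ => ?_
    rw [integral_const_mul, integral_indicator (hU j).measurableSet]
  have hsum : ∑ j ∈ T, |(∫ x in U j, u x) - ∫ x in U j, u (x + h)|
      = ∫ x, u x * (G x - G (x - h)) := by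
    have hu' : Integrable fun x => u (x + h) := hu.comp_add_right h
    have hi : Integrable fun x => u x * G (x - h) := by
      have := (hval _ hu').1.comp_sub_right h
      simpa using this
    -- Translation invariance moves the shift from the test function to `u`.
    have he : ∫ x, u x * G (x - h) = ∫ x, u (x + h) * G x := by
      rw [← integral_add_right_eq_self (fun x => u x * G (x - h)) h]
      simp
    simp only [mul_sub]
    rw [integral_sub (hval u hu).1 hi, he, (hval u hu).2, (hval _ hu').2,
      ← Finset.sum_sub_distrib]
    exact Finset.sum_congr rfl fun j _ => by rw [hsa, mul_sub]
  have htend : Filter.Tendsto (fun m => ∫ x, u x * (g m x - g m (x - h))) Filter.atTop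
      (nhds (∫ x, u x * (G x - G (x - h)))) := by
    refine tendsto_integral_of_dominated_convergence (fun x => |u x| * 2) ?_ ?_ ?_ ?_
    · intro m
      have := (hgd m).continuous
      exact hu.aestronglyMeasurable.mul
        (by fun_prop : Continuous fun x => g m x - g m (x - h)).aestronglyMeasurable
    · exact hu.abs.mul_const 2
    · intro m
      refine Filter.Eventually.of_forall fun x => ?_
      rw [Real.norm_eq_abs, abs_mul]
      gcongr
      calc |g m x - g m (x - h)| ≤ |g m x| + |g m (x - h)| := abs_sub _ _
        _ ≤ 2 := by linarith [hgb m x, hgb m (x - h)]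
    · exact Filter.Eventually.of_forall fun x =>
        ((hlim x).sub (hlim (x - h))).const_mul _
  rw [hsum]
  exact le_of_tendsto ((ENNReal.continuous_ofReal.tendsto _).comp htend)
    (Filter.Eventually.of_forall fun m =>
      ofReal_integral_mul_sub_le u (hgd m) (hgc m) (hgb m) h)

end Variation

/-! ### Basic cells, and a measurable choice of the cell of a point. -/

section CellGeometry

variable {d n : ℕ}

/-- The interior of a basic cell. -/
def openCell (i : Index d n) : Set (Space d) :=
  {x | ∀ l, x l ∈ Set.Ioo (((i l : ℕ) : ℝ) / n) ((((i l : ℕ) : ℝ) + 1) / n)}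

theorem isOpen_openCell (i : Index d n) : IsOpen (openCell i) := by
  have : openCell i = ⋂ l, {x : Space d |
      x l ∈ Set.Ioo (((i l : ℕ) : ℝ) / n) ((((i l : ℕ) : ℝ) + 1) / n)} := by
    ext x; simp [openCell]
  rw [this]
  exact isOpen_iInter_of_finite fun l => isOpen_Ioo.preimage (by fun_prop)

theorem isClosed_cell (i : Index d n) : IsClosed (cell i) := by
  have : cell i = ⋂ l, {x : Space d |
      x l ∈ Set.Icc (((i l : ℕ) : ℝ) / n) ((((i l : ℕ) : ℝ) + 1) / n)} := by
    ext x; simp [cell]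
  rw [this]
  exact isClosed_iInter fun l => isClosed_Icc.preimage (by fun_prop)

theorem convex_cell (i : Index d n) : Convex ℝ (cell i) := by
  intro x hx y hy a b ha hb hab l
  exact convex_Icc _ _ (hx l) (hy l) ha hb hab

theorem openCell_subset_cell (i : Index d n) : openCell i ⊆ cell i :=
  fun _ hx l => Set.Ioo_subset_Icc_self (hx l)

/-- Coordinate projections are open maps, so they send the interior of the cell into the interior of
an interval. -/
theorem interior_cell_subset (i : Index d n) : interior (cell i) ⊆ openCell i := by
  intro x hx l
  set p : Space d →L[ℝ] ℝ := EuclideanSpace.proj l with hp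
  have hsurj : Function.Surjective p := fun r => ⟨EuclideanSpace.single l r, by simp [hp]⟩
  have hop := p.isOpenMap hsurj
  rw [← interior_Icc]
  refine interior_maximal ?_ (hop _ isOpen_interior) ⟨x, hx, rfl⟩
  rintro _ ⟨y, hy, rfl⟩
  exact interior_subset hy l

theorem measurableSet_cell (i : Index d n) : MeasurableSet (cell i) :=
  (isClosed_cell i).measurableSet

theorem cell_subset_cube (i : Index d n) : cell i ⊆ cube d := by
  intro x hx l
  have hn : (0 : ℝ) < n := by exact_mod_cast (Nat.zero_le _).trans_lt (i l).2
  have h1 : ((i l : ℕ) : ℝ) + 1 ≤ n := by exact_mod_cast (i l).2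
  exact ⟨le_trans (by positivity) (hx l).1, (hx l).2.trans (by rw [div_le_one hn]; exact h1)⟩

theorem isBounded_openCell (i : Index d n) : Bornology.IsBounded (openCell i) := by
  refine Metric.isBounded_iff_subset_closedBall 0 |>.2 ⟨Real.sqrt d, fun x hx => ?_⟩
  rw [mem_closedBall_zero_iff, EuclideanSpace.norm_eq]
  refine Real.sqrt_le_sqrt ?_
  calc ∑ l, ‖x l‖ ^ 2 ≤ ∑ _l : Fin d, (1 : ℝ) := by
        refine Finset.sum_le_sum fun l _ => ?_
        have := cell_subset_cube i (openCell_subset_cell i hx) l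
        rw [Real.norm_eq_abs, sq_abs]
        nlinarith [this.1, this.2]
    _ = d := by simp

/-- A measure on the cube for which the boundaries of the basic cells are null sets. -/
def IsCellRegular (n : ℕ) (m : Measure (Space d)) : Prop :=
  m (cube d)ᶜ = 0 ∧ ∀ i : Index d n, m (frontier (cell i)) = 0

theorem IsCellRegular.of_absolutelyContinuous {μ : Measure (Space d)} (h : μ (cube d)ᶜ = 0)
    (hac : μ ≪ volume) : IsCellRegular n μ :=
  ⟨h, fun i => hac ((convex_cell i).addHaar_frontier volume)⟩

theorem cell_ae_eq_openCell {m : Measure (Space d)} (i : Index d n)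
    (hm : m (frontier (cell i)) = 0) : (openCell i : Set (Space d)) =ᵐ[m] cell i := by
  have h : ∀ᵐ x ∂m, x ∉ frontier (cell i) := measure_eq_zero_iff_ae_notMem.1 hm
  filter_upwards [h] with x hx
  refine propext ⟨fun h => openCell_subset_cell i h, fun h => interior_cell_subset i ?_⟩
  by_contra h'
  exact hx ⟨subset_closure h, h'⟩

theorem volume_cell (i : Index d n) : volume (cell i) = ((n : ℝ≥0∞) ^ d)⁻¹ := by
  have h : cell i = (@WithLp.ofLp 2 (Fin d → ℝ)) ⁻¹' (Set.pi Set.univ fun l =>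
      Set.Icc (((i l : ℕ) : ℝ) / n) ((((i l : ℕ) : ℝ) + 1) / n)) := by
    ext x; simp only [cell, Set.mem_preimage, Set.mem_pi, Set.mem_univ, true_imp_iff]; rfl
  rw [h, (PiLp.volume_preserving_ofLp (Fin d)).measure_preimage
    (MeasurableSet.univ_pi fun l => measurableSet_Icc).nullMeasurableSet, volume_pi_pi]
  have : ∀ l : Fin d, volume (Set.Icc (((i l : ℕ) : ℝ) / n) ((((i l : ℕ) : ℝ) + 1) / n))
      = (n : ℝ≥0∞)⁻¹ := by
    intro l
    have hn : (0 : ℝ) < n := by exact_mod_cast (Nat.zero_le _).trans_lt (i l).2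
    rw [Real.volume_Icc, ← sub_div, add_sub_cancel_left, ENNReal.ofReal_div_of_pos hn]
    simp
  simp [this, ENNReal.inv_pow]

variable [NeZero n]

/-- The basic cell in which a point of the cube lies, with a fixed choice on the cell boundaries. -/
noncomputable def cellIndex (n : ℕ) [NeZero n] (x : Space d) : Index d n :=
  fun l => ⟨min ⌊(n : ℝ) * x l⌋₊ (n - 1), by
    have := NeZero.pos n
    omega⟩

theorem measurable_cellIndex : Measurable (cellIndex (d := d) n) := by
  refine measurable_pi_iff.2 fun l => ?_
  have h1 : Measurable fun x : Space d => ⌊(n : ℝ) * x l⌋₊ :=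
    Nat.measurable_floor.comp (by fun_prop)
  have h2 : Measurable fun m : ℕ => (⟨min m (n - 1), by
    have := NeZero.pos n
    omega⟩ : Fin n) := measurable_of_countable _
  exact h2.comp h1

theorem cellIndex_eq_of_mem_openCell {i : Index d n} {x : Space d} (hx : x ∈ openCell i) :
    cellIndex n x = i := by
  have hn : (0 : ℝ) < n := by exact_mod_cast NeZero.pos n
  funext l
  have h1 := (hx l).1
  have h2 := (hx l).2
  rw [div_lt_iff₀ hn] at h1
  rw [lt_div_iff₀ hn] at h2
  have hf : ⌊(n : ℝ) * x l⌋₊ = (i l : ℕ) := by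
    rw [Nat.floor_eq_iff (le_trans (Nat.cast_nonneg (i l : ℕ)) (by linarith))]
    constructor <;> linarith
  have := (i l).2
  apply Fin.ext
  simp only [cellIndex, hf]
  omega

theorem mem_cell_cellIndex {x : Space d} (hx : x ∈ cube d) : x ∈ cell (cellIndex n x) := by
  have hn : (0 : ℝ) < n := by exact_mod_cast NeZero.pos n
  intro l
  have h0 := (hx l).1
  have h1 := (hx l).2
  have hf := Nat.floor_le (mul_nonneg hn.le h0)
  have hf' := Nat.lt_floor_add_one ((n : ℝ) * x l)
  simp only [cellIndex, Set.mem_Icc]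
  rw [div_le_iff₀ hn, le_div_iff₀ hn]
  rcases le_total ⌊(n : ℝ) * x l⌋₊ (n - 1) with h | h
  · rw [min_eq_left h]
    constructor <;> linarith
  · rw [min_eq_right h]
    have hc : ((n - 1 : ℕ) : ℝ) = n - 1 := by
      rw [Nat.cast_sub (NeZero.pos n), Nat.cast_one]
    have h' : ((n - 1 : ℕ) : ℝ) ≤ (⌊(n : ℝ) * x l⌋₊ : ℝ) := by exact_mod_cast h
    rw [hc] at h' ⊢
    constructor
    · linarith
    · nlinarith

theorem IsCellRegular.ae_mem_cell_iff {m : Measure (Space d)} (hm : IsCellRegular n m) :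
    ∀ᵐ x ∂m, ∀ i : Index d n, x ∈ cell i ↔ cellIndex n x = i := by
  have h1 : ∀ᵐ x ∂m, x ∈ cube d := hm.1
  rw [ae_all_iff]
  intro i
  filter_upwards [h1, (cell_ae_eq_openCell i (hm.2 i)).mem_iff] with x hx hi
  constructor
  · exact fun h => cellIndex_eq_of_mem_openCell (hi.2 h)
  · rintro rfl
    exact mem_cell_cellIndex hx

/-- Closed cells overlap on their faces, whereas preimages under `cellIndex` are genuinely disjoint;
up to null sets the former can be replaced by the latter. -/
theorem IsCellRegular.compositeCell_ae_eq {m : Measure (Space d)} (hm : IsCellRegular n m)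
    (J : Finset (Index d n)) :
    (compositeCell J : Set (Space d)) =ᵐ[m] cellIndex n ⁻¹' (J : Set (Index d n)) := by
  filter_upwards [hm.ae_mem_cell_iff] with x hx
  refine propext ?_
  change x ∈ ⋃ i ∈ J, cell i ↔ cellIndex n x ∈ (J : Set (Index d n))
  simp [hx]

theorem IsCellRegular.cell_ae_eq {m : Measure (Space d)} (hm : IsCellRegular n m)
    (i : Index d n) : (cell i : Set (Space d)) =ᵐ[m] cellIndex n ⁻¹' {i} := by
  filter_upwards [hm.ae_mem_cell_iff] with x hx
  exact propext (hx i)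

theorem measurableSet_cellIndex_preimage (S : Set (Index d n)) :
    MeasurableSet (cellIndex (d := d) n ⁻¹' S) :=
  measurable_cellIndex (Set.toFinite S).measurableSet

theorem restrict_cellIndex_preimage (m : Measure (Space d)) (J : Finset (Index d n)) :
    m.restrict (cellIndex n ⁻¹' (J : Set (Index d n)))
      = ∑ j ∈ J, m.restrict (cellIndex n ⁻¹' {j}) := by
  ext A hA
  rw [Measure.finsetSum_apply, Measure.restrict_apply hA]
  simp_rw [Measure.restrict_apply hA]
  rw [← measure_biUnion_finset]
  · congr 1; ext x; simp
  · intro i _ j _ hij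
    refine Set.disjoint_left.2 fun x hx hx' => hij ?_
    rw [← show cellIndex n x = i from hx.2]
    exact hx'.2
  · exact fun j _ => hA.inter (measurableSet_cellIndex_preimage _)

theorem sum_restrict_cellIndex (m : Measure (Space d)) :
    ∑ j, m.restrict (cellIndex n ⁻¹' {j}) = m := by
  rw [← restrict_cellIndex_preimage]
  simp

end CellGeometry

/-! ### Bounds for cell masses and for their change under shifts. -/

section CellMass

variable {d n : ℕ} {μ : Measure (Space d)} [IsFiniteMeasure μ]

theorem ofReal_density_ae_eq (μ : Measure (Space d)) [IsFiniteMeasure μ] :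
    ∀ᵐ x, ENNReal.ofReal (density μ x) = μ.rnDeriv volume x := by
  filter_upwards [μ.rnDeriv_lt_top volume] with x hx
  exact ENNReal.ofReal_toReal hx.ne

theorem measure_cell_le (hac : μ ≪ volume) {M : ℝ≥0}
    (hM : ∀ᵐ x ∂(volume.restrict (cube d)), density μ x ≤ (M : ℝ)) (i : Index d n) :
    μ (cell i) ≤ M * ((n : ℝ≥0∞) ^ d)⁻¹ := by
  rw [← Measure.setLIntegral_rnDeriv hac, ← volume_cell i, ← setLIntegral_const]
  refine lintegral_mono_ae ?_
  filter_upwards [ae_restrict_of_ae_restrict_of_subset (cell_subset_cube i) hM,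
    ae_restrict_of_ae (ofReal_density_ae_eq μ)] with x hx hx'
  rw [← hx', ← ENNReal.ofReal_coe_nnreal]
  exact ENNReal.ofReal_le_ofReal hx

theorem le_measure_cell (hac : μ ≪ volume) {M : ℝ≥0}
    (hM : ∀ᵐ x ∂(volume.restrict (cube d)), (M : ℝ) ≤ density μ x) (i : Index d n) :
    M * ((n : ℝ≥0∞) ^ d)⁻¹ ≤ μ (cell i) := by
  rw [← Measure.setLIntegral_rnDeriv hac, ← volume_cell i, ← setLIntegral_const]
  refine lintegral_mono_ae ?_
  filter_upwards [ae_restrict_of_ae_restrict_of_subset (cell_subset_cube i) hM,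
    ae_restrict_of_ae (ofReal_density_ae_eq μ)] with x hx hx'
  rw [← hx', ← ENNReal.ofReal_coe_nnreal]
  exact ENNReal.ofReal_le_ofReal hx

theorem setIntegral_openCell_density (hac : μ ≪ volume) (i : Index d n) :
    ∫ x in openCell i, density μ x = μ.real (cell i) := by
  have h : (openCell i : Set (Space d)) =ᵐ[volume] cell i :=
    cell_ae_eq_openCell i ((convex_cell i).addHaar_frontier volume)
  rw [setIntegral_congr_set h]
  exact Measure.setIntegral_toReal_rnDeriv hac (cell i)

theorem pairwise_disjoint_openCell [NeZero n] :
    Pairwise (Function.onFun Disjoint (openCell (d := d) (n := n))) := by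
  intro i j hij
  refine Set.disjoint_left.2 fun x hx hx' => hij ?_
  rw [← cellIndex_eq_of_mem_openCell hx, ← cellIndex_eq_of_mem_openCell hx']

theorem setIntegral_openCell_add (u : Space d → ℝ) {i j : Index d n} {h : Space d}
    (hij : ∀ l, ((j l : ℕ) : ℝ) / n = ((i l : ℕ) : ℝ) / n + h l) :
    ∫ x in openCell i, u (x + h) = ∫ x in openCell j, u x := by
  have : openCell i = (fun x => x + h) ⁻¹' openCell j := by
    ext x
    simp only [openCell, Set.mem_ofPred_eq, Set.mem_preimage, Set.mem_Ioo, PiLp.add_apply]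
    refine forall_congr' fun l => ?_
    rw [add_div, add_div, hij l, add_right_comm, add_lt_add_iff_right, add_lt_add_iff_right]
  rw [this]
  exact (measurePreserving_add_right volume h).setIntegral_preimage_emb
    (MeasurableEquiv.addRight h).measurableEmbedding u (openCell j)

/-- The masses of cells that differ by a fixed shift of at most two cells in each direction
differ by at most `2 √d / n` times the total variation of the density, in total. -/
theorem ofReal_sum_abs_measure_cell_sub_le [NeZero n] {ι : Type*} (hac : μ ≪ volume)
    (hu : Integrable (density μ)) (T : Finset ι) (a b : ι → Index d n)
    (ha : Set.InjOn a T) (v : Fin d → ℤ) (hv : ∀ l, |v l| ≤ 2)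
    (hab : ∀ t ∈ T, ∀ l, ((b t l : ℕ) : ℤ) = (a t l : ℕ) + v l) :
    ENNReal.ofReal (∑ t ∈ T, |μ.real (cell (a t)) - μ.real (cell (b t))|)
      ≤ ENNReal.ofReal (2 * Real.sqrt d / n) * totalVariation (density μ) := by
  have hn : (0 : ℝ) < n := by exact_mod_cast NeZero.pos n
  set h : Space d := WithLp.toLp 2 fun l => (v l : ℝ) / n with hh
  have hnorm : ‖h‖ ≤ 2 * Real.sqrt d / n := by
    rw [EuclideanSpace.norm_eq, Real.sqrt_le_left (by positivity)]
    calc ∑ l, ‖h l‖ ^ 2 ≤ ∑ _l : Fin d, (2 / (n : ℝ)) ^ 2 := by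
          refine Finset.sum_le_sum fun l _ => ?_
          have h2 : |(v l : ℝ)| ≤ 2 := by exact_mod_cast hv l
          rw [hh, Real.norm_eq_abs, abs_div, abs_of_pos hn]
          gcongr
      _ = (2 * Real.sqrt d / n) ^ 2 := by
          rw [Finset.sum_const, Finset.card_univ, Fintype.card_fin, nsmul_eq_mul,
            div_pow (2 * _), mul_pow, Real.sq_sqrt (Nat.cast_nonneg d)]
          ring
  -- As `a` is injective only on `T`, the cells are indexed by the subtype to make them pairwise
  -- disjoint.
  have key := ofReal_sum_abs_setIntegral_sub_le T.attach (fun t => openCell (a t))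
    (fun t => isOpen_openCell _) (fun t => isBounded_openCell _)
    (fun s t hst => pairwise_disjoint_openCell fun he => hst (Subtype.ext (ha s.2 t.2 he)))
    hu h
  have heq : ∑ t ∈ T.attach, |(∫ x in openCell (a t), density μ x)
        - ∫ x in openCell (a t), density μ (x + h)|
      = ∑ t ∈ T, |μ.real (cell (a t)) - μ.real (cell (b t))| := by
    rw [← Finset.sum_attach T]
    refine Finset.sum_congr rfl fun t _ => ?_
    rw [setIntegral_openCell_add (density μ) (j := b t), setIntegral_openCell_density hac,
      setIntegral_openCell_density hac]
    intro l
    have : ((b t l : ℕ) : ℝ) = ((a t l : ℕ) : ℝ) + v l := by exact_mod_cast hab t t.2 l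
    rw [this, add_div]
  rw [heq] at key
  refine key.trans ?_
  gcongr

end CellMass

/-! ### The blocks of the composite partitions. -/

section Blocks

variable {d n : ℕ}

/-- The block of the composite partition with shift `s` that contains `i`. -/
def block (s : ℕ) (i : Index d n) : Finset (Index d n) :=
  Finset.univ.filter fun j => ∀ l, ((j l : ℕ) + s) / 2 = ((i l : ℕ) + s) / 2

theorem mem_block {s : ℕ} {i j : Index d n} :
    j ∈ block s i ↔ ∀ l, ((j l : ℕ) + s) / 2 = ((i l : ℕ) + s) / 2 := by
  simp [block]

theorem self_mem_block (s : ℕ) (i : Index d n) : i ∈ block s i := mem_block.2 fun _ => rfl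

theorem block_eq_of_mem {s : ℕ} {i j : Index d n} (h : j ∈ block s i) :
    block s j = block s i := by
  rw [mem_block] at h
  ext m
  simp only [mem_block, h]

theorem mem_compositePartition {s : ℕ} {J : Finset (Index d n)} :
    J ∈ compositePartition d n s ↔ ∃ i, block s i = J := by
  simp [compositePartition, block]

theorem block_mem_compositePartition (s : ℕ) (i : Index d n) :
    block s i ∈ compositePartition d n s := mem_compositePartition.2 ⟨i, rfl⟩

theorem block_eq_of_mem_of_mem_compositePartition {s : ℕ} {J : Finset (Index d n)}
    (hJ : J ∈ compositePartition d n s) {j : Index d n} (hj : j ∈ J) : block s j = J := by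
  obtain ⟨i, rfl⟩ := mem_compositePartition.1 hJ
  exact block_eq_of_mem hj

theorem pairwiseDisjoint_compositePartition (s : ℕ) :
    (compositePartition d n s : Set (Finset (Index d n))).PairwiseDisjoint id := by
  intro J hJ J' hJ' hne
  refine Finset.disjoint_left.2 fun j hj hj' => hne ?_
  rw [← block_eq_of_mem_of_mem_compositePartition hJ hj,
    ← block_eq_of_mem_of_mem_compositePartition hJ' hj']

theorem sum_compositePartition {M : Type*} [AddCommMonoid M] (s : ℕ) (g : Index d n → M) :
    ∑ J ∈ compositePartition d n s, ∑ j ∈ J, g j = ∑ j, g j := by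
  have h : (Finset.univ : Finset (Index d n)) = (compositePartition d n s).biUnion id := by
    ext i
    simpa using ⟨block s i, block_mem_compositePartition s i, self_mem_block s i⟩
  rw [h, Finset.sum_biUnion (pairwiseDisjoint_compositePartition s)]
  rfl

/-- The shift of the partition of iteration `k`. -/
def iterShift (k : ℕ) : ℕ := if Odd k then 0 else 1

theorem iterPartition_eq (k : ℕ) : iterPartition d n k = compositePartition d n (iterShift k) := by
  unfold iterPartition iterShift
  split_ifs <;> rfl

end Blocks

/-! ### Cell and block marginals of a coupling. -/

section Marginals

variable {d n : ℕ}

theorem partialMarginal_apply (π : Measure (Space d × Space d)) (A : Set (Space d))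
    {B : Set (Space d)} (hB : MeasurableSet B) :
    partialMarginal π A B = π (Prod.fst ⁻¹' A ∩ Prod.snd ⁻¹' B) := by
  rw [partialMarginal, Measure.snd_apply hB, Measure.restrict_apply (measurable_snd hB),
    Set.prod_univ, Set.inter_comm]

theorem partialMarginal_congr {π : Measure (Space d × Space d)} {A A' : Set (Space d)}
    (h : A =ᵐ[π.fst] A') : partialMarginal π A = partialMarginal π A' := by
  have h' : (A ×ˢ Set.univ : Set (Space d × Space d)) =ᵐ[π] A' ×ˢ Set.univ := by
    rw [Set.prod_univ, Set.prod_univ]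
    exact (measurable_fst.measurePreserving π).quasiMeasurePreserving.preimage_ae_eq h
  rw [partialMarginal, partialMarginal, Measure.restrict_congr_set h']

theorem partialMarginal_univ (π : Measure (Space d × Space d)) {A : Set (Space d)}
    (hA : MeasurableSet A) : partialMarginal π A Set.univ = π.fst A := by
  rw [partialMarginal_apply _ _ MeasurableSet.univ, Measure.fst_apply hA]
  simp

theorem partialMarginal_apply_eq_zero {π : Measure (Space d × Space d)} (A : Set (Space d))
    {B : Set (Space d)} (hB : MeasurableSet B) (h : π.snd B = 0) :
    partialMarginal π A B = 0 := by
  rw [partialMarginal_apply _ _ hB]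
  rw [Measure.snd_apply hB] at h
  exact measure_mono_null Set.inter_subset_right h

/-- A measure on `X × Y` whose first marginal gives the basic cells the same masses as `μ`, and
whose second marginal is concentrated on `Y`. -/
structure IsAdapted (n : ℕ) (Y : Set (Space d)) (μ : Measure (Space d))
    (π : Measure (Space d × Space d)) : Prop where
  regular : IsCellRegular n π.fst
  mass : ∀ i : Index d n, π.fst (cell i) = μ (cell i)
  conc : π.snd Yᶜ = 0

variable {Y : Set (Space d)} {μ : Measure (Space d)} {π : Measure (Space d × Space d)}

theorem IsAdapted.partialMarginal_cell_univ (h : IsAdapted n Y μ π) (i : Index d n) :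
    partialMarginal π (cell i) Set.univ = μ (cell i) := by
  rw [partialMarginal_univ π (measurableSet_cell i), h.mass]

theorem IsAdapted.isProbabilityMeasure_cellMarginal [IsFiniteMeasure μ] (h : IsAdapted n Y μ π)
    {i : Index d n} (hi : μ (cell i) ≠ 0) : IsProbabilityMeasure (cellMarginal μ π i) := by
  constructor
  rw [cellMarginal, Measure.smul_apply, h.partialMarginal_cell_univ, smul_eq_mul,
    ENNReal.inv_mul_cancel hi (measure_ne_top _ _)]

theorem IsAdapted.cellMarginal_compl (h : IsAdapted n Y μ π) (hY : MeasurableSet Y)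
    (i : Index d n) : cellMarginal μ π i Yᶜ = 0 := by
  rw [cellMarginal, Measure.smul_apply, partialMarginal_apply_eq_zero _ hY.compl h.conc, smul_zero]

theorem IsAdapted.compositeMarginal_compl (h : IsAdapted n Y μ π) (hY : MeasurableSet Y)
    (J : Finset (Index d n)) : compositeMarginal μ π J Yᶜ = 0 := by
  rw [compositeMarginal, Measure.smul_apply, partialMarginal_apply_eq_zero _ hY.compl h.conc,
    smul_zero]

theorem IsAdapted.partialMarginal_compositeCell [NeZero n] (h : IsAdapted n Y μ π)
    (J : Finset (Index d n)) :
    partialMarginal π (compositeCell J) = ∑ j ∈ J, partialMarginal π (cell j) := by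
  rw [partialMarginal_congr (h.regular.compositeCell_ae_eq J),
    Finset.sum_congr rfl fun j _ => partialMarginal_congr (h.regular.cell_ae_eq j)]
  ext B hB
  rw [Measure.finsetSum_apply, partialMarginal_apply _ _ hB]
  simp_rw [partialMarginal_apply _ _ hB]
  rw [← measure_biUnion_finset]
  · congr 1; ext x; simp
  · intro i _ j _ hij
    refine Set.disjoint_left.2 fun x hx hx' => hij ?_
    rw [← show cellIndex n x.1 = i from hx.1]
    exact hx'.1
  · exact fun j _ => (measurable_fst (measurableSet_cellIndex_preimage _)).inter
      (measurable_snd hB)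

/-- Block marginals are mass-weighted averages of cell marginals, so two blocks can be compared cell
by cell. -/
theorem IsAdapted.compositeMarginal_eq [NeZero n] [IsFiniteMeasure μ] (h : IsAdapted n Y μ π)
    (hpos : ∀ i : Index d n, μ (cell i) ≠ 0) (J : Finset (Index d n)) :
    compositeMarginal μ π J
      = ∑ j ∈ J, (μ (cell j) / ∑ i ∈ J, μ (cell i)) • cellMarginal μ π j := by
  rw [compositeMarginal, h.partialMarginal_compositeCell, Finset.smul_sum]
  refine Finset.sum_congr rfl fun j _ => ?_
  rw [cellMarginal, smul_smul, div_eq_mul_inv, mul_right_comm,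
    ENNReal.mul_inv_cancel (hpos j) (measure_ne_top _ _), one_mul]

theorem IsAdapted.isProbabilityMeasure_compositeMarginal [NeZero n] [IsFiniteMeasure μ]
    (h : IsAdapted n Y μ π) (hpos : ∀ i : Index d n, μ (cell i) ≠ 0)
    {J : Finset (Index d n)} (hJ : J.Nonempty) :
    IsProbabilityMeasure (compositeMarginal μ π J) := by
  constructor
  obtain ⟨j, hj⟩ := hJ
  rw [compositeMarginal, Measure.smul_apply, h.partialMarginal_compositeCell,
    Measure.finsetSum_apply, Finset.sum_congr rfl fun i _ => h.partialMarginal_cell_univ i,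
    smul_eq_mul, ENNReal.inv_mul_cancel]
  · intro h0
    exact hpos j (Finset.sum_eq_zero_iff.1 h0 j hj)
  · exact (ENNReal.sum_lt_top.2 fun i _ => measure_lt_top _ _).ne

end Marginals

/-! ### Quantities preserved by the iterations. -/

section Iterates

variable {d n : ℕ} {Y : Set (Space d)} {μ : Measure (Space d)} {P : LevelData d}
  {π : ℕ → Measure (Space d × Space d)}

theorem LevelData.IsAdmissible.isCellRegular (hP : P.IsAdmissible Y μ n) :
    IsCellRegular n P.margX := ⟨hP.margX_cube, hP.margX_frontier⟩

variable [NeZero n]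

theorem fst_finsetSum {ι E F : Type*} [MeasurableSpace E] [MeasurableSpace F] (s : Finset ι)
    (σ : ι → Measure (E × F)) : (∑ j ∈ s, σ j).fst = ∑ j ∈ s, (σ j).fst := by
  ext A hA
  simp [Measure.fst_apply hA, Measure.finsetSum_apply]

theorem snd_finsetSum {ι E F : Type*} [MeasurableSpace E] [MeasurableSpace F] (s : Finset ι)
    (σ : ι → Measure (E × F)) : (∑ j ∈ s, σ j).snd = ∑ j ∈ s, (σ j).snd := by
  ext A hA
  simp [Measure.snd_apply hA, Measure.finsetSum_apply]

theorem sum_restrict_compositeCell {m : Measure (Space d)} (hm : IsCellRegular n m) (s : ℕ) :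
    ∑ J ∈ compositePartition d n s, m.restrict (compositeCell J) = m := by
  conv_rhs => rw [← sum_restrict_cellIndex (n := n) m, ← sum_compositePartition s]
  refine Finset.sum_congr rfl fun J _ => ?_
  rw [Measure.restrict_congr_set (hm.compositeCell_ae_eq J), restrict_cellIndex_preimage]

theorem IsIterates.marginals (hP : P.IsAdmissible Y μ n) (hY : MeasurableSet Y)
    (hπ : IsIterates n P π) (k : ℕ) : (π k).fst = P.margX ∧ (π k).snd Yᶜ = 0 := by
  induction k with
  | zero =>
    rw [hπ.1]
    exact ⟨hP.init_mem.1, by rw [hP.init_mem.2]; exact hP.margY_Y⟩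
  | succ k ih =>
    obtain ⟨σ, hσ, hsum⟩ := hπ.2 k
    rw [hsum, fst_finsetSum, snd_finsetSum]
    constructor
    · rw [Finset.sum_congr rfl fun J hJ => (hσ J hJ).1.1, iterPartition_eq]
      exact sum_restrict_compositeCell hP.isCellRegular _
    · rw [Measure.finsetSum_apply]
      refine Finset.sum_eq_zero fun J hJ => ?_
      rw [(hσ J hJ).1.2]
      exact partialMarginal_apply_eq_zero _ hY.compl ih.2

theorem IsIterates.isAdapted (hP : P.IsAdmissible Y μ n) (hY : MeasurableSet Y)
    (hπ : IsIterates n P π) (k : ℕ) : IsAdapted n Y μ (π k) := by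
  obtain ⟨h1, h2⟩ := hπ.marginals hP hY k
  exact ⟨h1 ▸ hP.isCellRegular, fun i => by rw [h1, hP.margX_cell], h2⟩

/-- An iteration does not change the partial marginals on the cells of its partition. -/
theorem IsIterates.partialMarginal_succ (hP : P.IsAdmissible Y μ n) (hY : MeasurableSet Y)
    (hπ : IsIterates n P π) (k : ℕ) {J : Finset (Index d n)}
    (hJ : J ∈ iterPartition d n (k + 1)) :
    partialMarginal (π (k + 1)) (compositeCell J) = partialMarginal (π k) (compositeCell J) := by
  obtain ⟨σ, hσ, hsum⟩ := hπ.2 k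
  have hreg := hP.isCellRegular
  set Z := fun J : Finset (Index d n) => cellIndex (d := d) n ⁻¹' (J : Set (Index d n)) with hZ
  have hZm : ∀ J, MeasurableSet (Z J) := fun J => measurableSet_cellIndex_preimage _
  have hfst : ∀ J' ∈ iterPartition d n (k + 1), (σ J').fst = P.margX.restrict (Z J') := by
    intro J' hJ'
    rw [(hσ J' hJ').1.1, Measure.restrict_congr_set (hreg.compositeCell_ae_eq J')]
  have h1 : partialMarginal (π (k + 1)) (compositeCell J)
      = partialMarginal (π (k + 1)) (Z J) := by
    apply partialMarginal_congr
    rw [(hπ.marginals hP hY (k + 1)).1]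
    exact hreg.compositeCell_ae_eq J
  ext B hB
  -- Over `Z J` only the summand `σ J` has mass, because every other `σ J'` lives over the disjoint
  -- set `Z J'`; the second marginal of `σ J` is prescribed.
  rw [h1, ← (hσ J hJ).1.2, partialMarginal_apply _ _ hB, hsum, Measure.finsetSum_apply,
    Finset.sum_eq_single J, Measure.snd_apply hB]
  · have h2 : σ J (Prod.fst ⁻¹' (Z J)ᶜ) = 0 := by
      rw [← Measure.fst_apply (hZm J).compl, hfst J hJ, Measure.restrict_apply (hZm J).compl]
      simp
    refine measure_congr ?_
    have h3 : ∀ᵐ z ∂(σ J), z.1 ∈ Z J := h2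
    filter_upwards [h3] with z hz
    exact propext ⟨fun h => h.2, fun h => ⟨hz, h⟩⟩
  · intro J' hJ' hne
    refine measure_mono_null Set.inter_subset_left ?_
    rw [← Measure.fst_apply (hZm J), hfst J' hJ', Measure.restrict_apply (hZm J)]
    have : Z J ∩ Z J' = ∅ := by
      rw [iterPartition_eq] at hJ hJ'
      have hd : Disjoint J J' := pairwiseDisjoint_compositePartition _ hJ hJ' hne.symm
      ext x
      simp only [hZ, Set.mem_inter_iff, Set.mem_preimage, Finset.mem_coe, Set.mem_empty_iff_false,
        iff_false, not_and]
      exact fun h h' => Finset.disjoint_left.1 hd h h'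
    rw [this, measure_empty]
  · exact fun h => absurd hJ h

theorem IsIterates.compositeMarginal_succ (hP : P.IsAdmissible Y μ n) (hY : MeasurableSet Y)
    (hπ : IsIterates n P π) (k : ℕ) (i : Index d n) :
    compositeMarginal μ (π (k + 1)) (block (iterShift (k + 1)) i)
      = compositeMarginal μ (π k) (block (iterShift (k + 1)) i) := by
  unfold compositeMarginal
  rw [hπ.partialMarginal_succ hP hY k]
  rw [iterPartition_eq]
  exact block_mem_compositePartition _ i

end Iterates

/-! ### The trajectory as a kernel, and its increments as finite sums. -/

section Trajectory

variable {d n : ℕ} [NeZero n] {Y : Set (Space d)} {μ : Measure (Space d)}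

/-- The kernel that is constant on each basic cell. -/
noncomputable def cellKernel (ρ : Index d n → Measure (Space d)) : Kernel (Space d) (Space d) where
  toFun x := ρ (cellIndex n x)
  measurable' := (measurable_of_countable ρ).comp measurable_cellIndex

theorem cellKernel_apply (ρ : Index d n → Measure (Space d)) (x : Space d) :
    cellKernel ρ x = ρ (cellIndex n x) := rfl

instance isMarkovKernel_cellKernel (ρ : Index d n → Measure (Space d))
    [∀ i, IsProbabilityMeasure (ρ i)] : IsMarkovKernel (cellKernel ρ) :=
  ⟨fun x => by rw [cellKernel_apply]; infer_instance⟩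

theorem lintegral_eq_sum_cellIndex (μ : Measure (Space d)) (f : Space d → ℝ≥0∞) :
    ∫⁻ x, f x ∂μ = ∑ i : Index d n, ∫⁻ x in cellIndex n ⁻¹' {i}, f x ∂μ := by
  conv_lhs => rw [← sum_restrict_cellIndex (n := n) μ]
  rw [lintegral_finsetSum_measure]

/-- This exhibits an explicit disintegration of the trajectory, so that `verticalDist_eq` applies.
-/
theorem sum_prod_eq_compProd_cellKernel [IsFiniteMeasure μ] (hμ : IsCellRegular n μ) (s : ℕ)
    (ρ : Finset (Index d n) → Measure (Space d))
    [∀ i, IsProbabilityMeasure (ρ (block s i))] :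
    ∑ J ∈ compositePartition d n s, (μ.restrict (compositeCell J)).prod (ρ J)
      = μ ⊗ₘ cellKernel fun i => ρ (block s i) := by
  ext S hS
  rw [Measure.compProd_apply hS, lintegral_eq_sum_cellIndex (n := n), ← sum_compositePartition s,
    Measure.finsetSum_apply]
  refine Finset.sum_congr rfl fun J hJ => ?_
  have : IsProbabilityMeasure (ρ J) := by
    obtain ⟨i, rfl⟩ := mem_compositePartition.1 hJ
    infer_instance
  rw [Measure.prod_apply hS, Measure.restrict_congr_set (hμ.compositeCell_ae_eq J),
    restrict_cellIndex_preimage, lintegral_finsetSum_measure]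
  refine Finset.sum_congr rfl fun j hj => ?_
  refine setLIntegral_congr_fun (measurableSet_cellIndex_preimage _) fun x hx => ?_
  have hx' : cellIndex n x = j := hx
  simp only [cellKernel_apply, hx', block_eq_of_mem_of_mem_compositePartition hJ hj]

theorem verticalDist_cellKernel_eq [IsFiniteMeasure μ] (hμ : IsCellRegular n μ)
    (ρ ρ' : Index d n → Measure (Space d)) [∀ i, IsProbabilityMeasure (ρ i)]
    [∀ i, IsProbabilityMeasure (ρ' i)] :
    verticalDist μ (μ ⊗ₘ cellKernel ρ) (μ ⊗ₘ cellKernel ρ')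
      = ∑ i, μ (cell i) * wasserstein (ρ i) (ρ' i) := by
  rw [verticalDist_eq, lintegral_eq_sum_cellIndex (n := n)]
  refine Finset.sum_congr rfl fun i _ => ?_
  rw [measure_congr (hμ.cell_ae_eq i), mul_comm, ← setLIntegral_const]
  refine setLIntegral_congr_fun (measurableSet_cellIndex_preimage _) fun x hx => ?_
  have hx' : cellIndex n x = i := hx
  simp only [cellKernel_apply, hx']

theorem verticalDist_trajectory_eq {P : LevelData d} {π : ℕ → Measure (Space d × Space d)}
    [IsFiniteMeasure μ] (hμ : IsCellRegular n μ) (hpos : ∀ i : Index d n, μ (cell i) ≠ 0)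
    (hP : P.IsAdmissible Y μ n) (hY : MeasurableSet Y) (hπ : IsIterates n P π) (k : ℕ) :
    verticalDist μ (trajectory μ n π ((k : ℝ) / n)) (trajectory μ n π (((k : ℝ) + 1) / n))
      = ∑ i : Index d n, μ (cell i) *
        wasserstein (compositeMarginal μ (π k) (block (iterShift k) i))
          (compositeMarginal μ (π k) (block (iterShift (k + 1)) i)) := by
  have hn : (n : ℝ) ≠ 0 := by exact_mod_cast NeZero.ne n
  have hk : ⌊(n : ℝ) * ((k : ℝ) / n)⌋₊ = k := by
    rw [mul_div_cancel₀ _ hn, Nat.floor_natCast]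
  have hk' : ⌊(n : ℝ) * (((k : ℝ) + 1) / n)⌋₊ = k + 1 := by
    rw [mul_div_cancel₀ _ hn, ← Nat.cast_succ, Nat.floor_natCast]
  have hprob : ∀ m s (i : Index d n),
      IsProbabilityMeasure (compositeMarginal μ (π m) (block s i)) := fun m s i =>
    (hπ.isAdapted hP hY m).isProbabilityMeasure_compositeMarginal hpos ⟨i, self_mem_block s i⟩
  unfold trajectory
  rw [hk, hk', iterPartition_eq, iterPartition_eq, sum_prod_eq_compProd_cellKernel hμ,
    sum_prod_eq_compProd_cellKernel hμ, verticalDist_cellKernel_eq hμ]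
  -- Both families of block marginals now belong to the same coupling `π k`.
  simp_rw [hπ.compositeMarginal_succ hP hY k]

end Trajectory

/-! ### Combinatorics of blocks: reflections within a block and boundary cells. -/

section Reflections

variable {d n : ℕ}

/-- The other cell of the one-dimensional block that contains `x`, for the partition with shift
`s`; it is `x` itself where there is none. -/
def partner (s : ℕ) (x : Fin n) : Fin n :=
  -- At `x = 0` with `s` odd the truncated subtraction returns `0`; at the right end `x + 1 = n`
  -- fails the test.
  if h : (if ((x : ℕ) + s) % 2 = 0 then (x : ℕ) + 1 else x - 1) < n then ⟨_, h⟩ else x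

/-- Replace the coordinates `l ∈ S` of `i` by their partners for the shifts `e l`. -/
def reflect (e : Fin d → ℕ) (S : Finset (Fin d)) (i : Index d n) : Index d n :=
  fun l => if l ∈ S then partner (e l) (i l) else i l

/-- The cells that do not touch the boundary of the cube. -/
def interiorCells (d n : ℕ) : Finset (Index d n) :=
  Finset.univ.filter fun i => ∀ l, 1 ≤ (i l : ℕ) ∧ (i l : ℕ) + 2 ≤ n

theorem mem_interiorCells {i : Index d n} :
    i ∈ interiorCells d n ↔ ∀ l, 1 ≤ (i l : ℕ) ∧ (i l : ℕ) + 2 ≤ n := by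
  simp [interiorCells]

theorem partner_val {s : ℕ} {x : Fin n} (hx : (x : ℕ) + 2 ≤ n) :
    (partner s x : ℕ) = if ((x : ℕ) + s) % 2 = 0 then (x : ℕ) + 1 else x - 1 := by
  unfold partner
  have : (if ((x : ℕ) + s) % 2 = 0 then (x : ℕ) + 1 else x - 1) < n := by split_ifs <;> omega
  rw [dif_pos this]

theorem reflect_injOn (e : Fin d → ℕ) (S : Finset (Fin d)) :
    Set.InjOn (reflect (n := n) e S) (interiorCells d n) := by
  intro i hi j hj hij
  rw [Finset.mem_coe, mem_interiorCells] at hi hj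
  funext l
  have h := congrFun hij l
  unfold reflect at h
  split_ifs at h
  · have h' := congrArg Fin.val h
    rw [partner_val (hi l).2, partner_val (hj l).2] at h'
    have h1 := hi l
    have h2 := hj l
    apply Fin.ext
    -- The parity of the partner reveals which branch produced it, and `1 ≤ x` excludes truncation.
    split_ifs at h' <;> omega
  · exact h

/-- A cell of the block is determined by the set of directions in which it differs from `i`. Both
partitions thereby share the index set `Finset (Fin d)`, which matches their cells. -/
theorem sum_block_eq {M : Type*} [AddCommMonoid M] {s : ℕ} (_hs : s ≤ 1) {i : Index d n}
    (hi : i ∈ interiorCells d n) (g : Index d n → M) :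
    ∑ j ∈ block s i, g j = ∑ S : Finset (Fin d), g (reflect (fun _ => s) S i) := by
  rw [mem_interiorCells] at hi
  symm
  refine Finset.sum_nbij' (fun S => reflect (fun _ => s) S i)
    (fun j => Finset.univ.filter fun l => j l ≠ i l) ?_ ?_ ?_ ?_ ?_
  · intro S _
    rw [mem_block]
    intro l
    have := hi l
    unfold reflect
    split_ifs
    · rw [partner_val (hi l).2]
      dsimp only
      split_ifs <;> omega
    · rfl
  · intro j _
    exact Finset.mem_univ _
  · intro S _
    ext l
    have := hi l
    simp only [Finset.mem_filter, Finset.mem_univ, true_and, reflect]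
    split_ifs with h
    · refine ⟨fun _ => h, fun _ he => ?_⟩
      have he' := congrArg Fin.val he
      rw [partner_val (hi l).2] at he'
      split_ifs at he' <;> omega
    · simp [h]
  · intro j hj
    rw [mem_block] at hj
    funext l
    have h1 := hi l
    have h2 := hj l
    simp only [reflect, Finset.mem_filter, Finset.mem_univ, true_and]
    split_ifs with h
    · apply Fin.ext
      rw [partner_val (hi l).2]
      have h' : (j l : ℕ) ≠ i l := fun he => h (Fin.ext he)
      split_ifs <;> omega
    · exact (not_not.1 h).symm
  · intro S _
    rfl

theorem card_filter_apply_eq (l : Fin d) (c : Fin n) :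
    (Finset.univ.filter fun i : Index d n => i l = c).card = n ^ (d - 1) := by
  have h : (Finset.univ.filter fun i : Index d n => i l = c)
      = Fintype.piFinset fun m => if m = l then {c} else Finset.univ := by
    ext i
    simp only [Finset.mem_filter, Finset.mem_univ, true_and, Fintype.mem_piFinset]
    refine ⟨fun h m => ?_, fun h => by simpa using h l⟩
    split_ifs with hm
    · rw [hm, h]; exact Finset.mem_singleton_self c
    · exact Finset.mem_univ _
  rw [h, Fintype.card_piFinset, ← Finset.mul_prod_erase _ _ (Finset.mem_univ l),
    Finset.prod_congr rfl fun m hm => by rw [if_neg (Finset.ne_of_mem_erase hm)]]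
  simp

theorem card_compl_interiorCells_le [NeZero n] :
    (interiorCells d n)ᶜ.card ≤ 2 * d * n ^ (d - 1) := by
  have hn := NeZero.pos n
  have hsub : (interiorCells d n)ᶜ ⊆ Finset.univ.biUnion fun l : Fin d =>
      (Finset.univ.filter fun i : Index d n => i l = ⟨0, hn⟩) ∪
        Finset.univ.filter fun i : Index d n => i l = ⟨n - 1, by omega⟩ := by
    intro i hi
    rw [Finset.mem_compl, mem_interiorCells, not_forall] at hi
    obtain ⟨l, hl⟩ := hi
    simp only [Finset.mem_biUnion, Finset.mem_univ, true_and, Finset.mem_union,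
      Finset.mem_filter, Fin.ext_iff]
    refine ⟨l, ?_⟩
    have := (i l).2
    omega
  refine (Finset.card_le_card hsub).trans (Finset.card_biUnion_le.trans ?_)
  refine (Finset.sum_le_sum fun l _ => Finset.card_union_le _ _).trans ?_
  simp only [card_filter_apply_eq, Finset.sum_const, Finset.card_univ, Fintype.card_fin,
    smul_eq_mul]
  exact le_of_eq (by ring)

end Reflections

/-! ### Chains of double steps, bounded by the pair sum of `WTVB`. -/

section PairSums

variable {d n : ℕ} (w : Index d n → Index d n → ℝ≥0∞)

theorem sum_le_pairSum (A : Finset (Index d n)) (a b : Index d n → Index d n)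
    (ha : Set.InjOn a A)
    (hab : ∀ i ∈ A, ∃ l, ∀ m, (a i m : ℕ) = (b i m : ℕ) + (if m = l then 2 else 0)) :
    ∑ i ∈ A, w (a i) (b i)
      ≤ ∑ p : Index d n × Index d n with
        ∃ l, ∀ m, (p.1 m : ℕ) = (p.2 m : ℕ) + (if m = l then 2 else 0), w p.1 p.2 := by
  classical
  have h1 : ∑ i ∈ A, w (a i) (b i) = ∑ p ∈ A.image fun i => (a i, b i), w p.1 p.2 := by
    rw [Finset.sum_image]
    intro i hi j hj hij
    exact ha hi hj (congrArg Prod.fst hij)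
  rw [h1]
  refine Finset.sum_le_sum_of_subset fun p hp => ?_
  obtain ⟨i, hi, rfl⟩ := Finset.mem_image.1 hp
  exact Finset.mem_filter.2 ⟨Finset.mem_univ _, hab i hi⟩

variable (hself : ∀ i, w i i = 0) (hcomm : ∀ i j, w i j = w j i)
  (htri : ∀ i j k, w i k ≤ w i j + w j k)

include hself hcomm in
-- Flipping the shift in direction `l` exchanges the right and left neighbours there, a move by two
-- cells if `l ∈ S` and none otherwise. The parity of `i l + e l` decides which end is larger;
-- within one parity class injectivity of `reflect` uses each pair at most once, whence the factor
-- `2`.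
theorem sum_reflect_update_le {e e' : Fin d → ℕ} {l : Fin d} (he : e l ≤ 1) (hel : e' l = 1 - e l)
    (hne : ∀ m, m ≠ l → e' m = e m) (S : Finset (Fin d)) :
    ∑ i ∈ interiorCells d n, w (reflect e S i) (reflect e' S i)
      ≤ 2 * ∑ p : Index d n × Index d n with
        ∃ l, ∀ m, (p.1 m : ℕ) = (p.2 m : ℕ) + (if m = l then 2 else 0), w p.1 p.2 := by
  by_cases hl : l ∈ S
  · have hcoord : ∀ i : Index d n, ∀ m, m ≠ l → reflect e S i m = reflect e' S i m := by
      intro i m hm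
      simp only [reflect, hne m hm]
    have hval : ∀ i ∈ interiorCells d n,
        ((i l : ℕ) + e l) % 2 = 0 ∧ (reflect e S i l : ℕ) = (reflect e' S i l : ℕ) + 2 ∨
        ¬ ((i l : ℕ) + e l) % 2 = 0 ∧ (reflect e' S i l : ℕ) = (reflect e S i l : ℕ) + 2 := by
      intro i hi
      have h := mem_interiorCells.1 hi l
      simp only [reflect, if_pos hl, partner_val h.2, hel]
      split_ifs <;> omega
    rw [← Finset.sum_filter_add_sum_filter_not (interiorCells d n)
      (fun i => ((i l : ℕ) + e l) % 2 = 0), two_mul]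
    refine add_le_add ?_ ?_
    · refine sum_le_pairSum w _ _ _ ((reflect_injOn e S).mono ?_) ?_
      · exact fun i hi => Finset.mem_of_mem_filter i hi
      · intro i hi
        rw [Finset.mem_filter] at hi
        refine ⟨l, fun m => ?_⟩
        split_ifs with hm
        · subst hm
          rcases hval i hi.1 with h | h
          · exact h.2
          · exact absurd hi.2 h.1
        · rw [hcoord i m hm, add_zero]
    · simp_rw [hcomm (reflect e S _)]
      refine sum_le_pairSum w _ _ _ ((reflect_injOn e' S).mono ?_) ?_
      · exact fun i hi => Finset.mem_of_mem_filter i hi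
      · intro i hi
        rw [Finset.mem_filter] at hi
        refine ⟨l, fun m => ?_⟩
        split_ifs with hm
        · subst hm
          rcases hval i hi.1 with h | h
          · exact absurd h.1 hi.2
          · exact h.2
        · rw [hcoord i m hm, add_zero]
  · have : ∀ i : Index d n, reflect e' S i = reflect e S i := by
      intro i
      funext m
      by_cases hm : m = l
      · subst hm; simp [reflect, hl]
      · simp only [reflect, hne m hm]
    simp only [this, hself, Finset.sum_const_zero]
    exact zero_le

include hself hcomm htri in
theorem sum_reflect_le {s : ℕ} (hs : s ≤ 1) (S : Finset (Fin d)) :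
    ∑ i ∈ interiorCells d n, w (reflect (fun _ => s) S i) (reflect (fun _ => 1 - s) S i)
      ≤ 2 * d * ∑ p : Index d n × Index d n with
        ∃ l, ∀ m, (p.1 m : ℕ) = (p.2 m : ℕ) + (if m = l then 2 else 0), w p.1 p.2 := by
  -- The shift is flipped one direction at a time; `T` holds the directions already flipped.
  have key : ∀ T : Finset (Fin d), ∑ i ∈ interiorCells d n,
      w (reflect (fun _ => s) S i) (reflect (fun m => if m ∈ T then 1 - s else s) S i)
      ≤ 2 * T.card * ∑ p : Index d n × Index d n with
        ∃ l, ∀ m, (p.1 m : ℕ) = (p.2 m : ℕ) + (if m = l then 2 else 0), w p.1 p.2 := by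
    intro T
    induction T using Finset.induction_on with
    | empty => simp [hself]
    | insert l T hl ih =>
      refine (Finset.sum_le_sum fun i _ => htri _
        (reflect (fun m => if m ∈ T then 1 - s else s) S i) _).trans ?_
      rw [Finset.sum_add_distrib, Finset.card_insert_of_notMem hl, Nat.cast_add, Nat.cast_one,
        mul_add, add_mul, mul_one]
      refine add_le_add ih (sum_reflect_update_le w hself hcomm (l := l) ?_ ?_ ?_ S)
      · simpa [hl] using hs
      · simp [hl]
      · intro m hm
        simp [hm]
  simpa using key Finset.univ

end PairSums

/-! ### Comparison of normalized averages with different weights. -/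

section Weights

theorem wasserstein_normalized_le {E : Type*} [MeasurableSpace E] [PseudoEMetricSpace E]
    [OpensMeasurableSpace E] [SecondCountableTopology E] {ι : Type*} (t : Finset ι) {Y : Set E}
    (p q : ι → ℝ≥0) {L : ℝ≥0} (hL : 0 < L) (hLp : L ≤ ∑ j ∈ t, p j) (hLq : L ≤ ∑ j ∈ t, q j)
    (ρ ρ' : ι → Measure E) [∀ j, IsProbabilityMeasure (ρ j)]
    [∀ j, IsProbabilityMeasure (ρ' j)] (hρ : ∀ j, ρ j Yᶜ = 0) (hρ' : ∀ j, ρ' j Yᶜ = 0) :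
    wasserstein (∑ j ∈ t, (p j / ∑ i ∈ t, p i) • ρ j) (∑ j ∈ t, (q j / ∑ i ∈ t, q i) • ρ' j)
      ≤ ∑ j ∈ t, wasserstein (ρ j) (ρ' j)
        + Metric.ediam Y * (∑ j ∈ t, ENNReal.ofReal |(p j : ℝ) - q j|) / L := by
  set P := ∑ i ∈ t, p i with hP
  set Q := ∑ i ∈ t, q i with hQ
  have hP0 : 0 < P := hL.trans_le hLp
  have hQ0 : 0 < Q := hL.trans_le hLq
  have hM0 : 0 < max P Q := lt_max_of_lt_left hP0
  have hmin : ∀ j ∈ t, min (p j) (q j) / max P Q ≤ 1 := by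
    intro j hj
    rw [div_le_one hM0]
    exact (min_le_left _ _).trans
      ((Finset.single_le_sum (fun _ _ => zero_le) hj).trans (le_max_left _ _))
  -- This common weight lies below both `p j / P` and `q j / Q`.
  refine (wasserstein_weighted_le t (Y := Y) (fun j => min (p j) (q j) / max P Q) _ _ ρ ρ'
    hρ hρ' ?_ ?_ ?_ ?_).trans (add_le_add ?_ ?_)
  · exact fun j _ => div_le_div₀ zero_le (min_le_left _ _) hP0 (le_max_left _ _)
  · exact fun j _ => div_le_div₀ zero_le (min_le_right _ _) hQ0 (le_max_right _ _)
  · rw [← Finset.sum_div, div_self hP0.ne']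
  · rw [← Finset.sum_div, div_self hQ0.ne']
  · refine Finset.sum_le_sum fun j hj => ?_
    calc _ ≤ 1 * wasserstein (ρ j) (ρ' j) := by
          gcongr
          exact_mod_cast hmin j hj
      _ = _ := one_mul _
  · rw [mul_div_assoc]
    refine mul_le_mul_right ?_ _
    rw [← ENNReal.ofReal_sum_of_nonneg fun _ _ => abs_nonneg _, ← ENNReal.ofReal_coe_nnreal,
      ← ENNReal.ofReal_coe_nnreal (p := L), ← ENNReal.ofReal_div_of_pos (by exact_mod_cast hL)]
    refine ENNReal.ofReal_le_ofReal ?_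
    -- Termwise, the larger of two numbers is the smaller plus their difference.
    have hd : max P Q ≤ (∑ j ∈ t, Real.nnabs ((p j : ℝ) - q j)) + ∑ j ∈ t, min (p j) (q j) := by
      rw [← Finset.sum_add_distrib]
      refine max_le (Finset.sum_le_sum fun j _ => ?_) (Finset.sum_le_sum fun j _ => ?_)
      all_goals
        rw [← NNReal.coe_le_coe]
        push_cast
        rcases le_total (p j : ℝ) (q j) with h | h
        · rw [min_eq_left h, abs_of_nonpos (by linarith)]
          linarith
        · rw [min_eq_right h, abs_of_nonneg (by linarith)]
          linarith
    have h1 : (1 - ∑ j ∈ t, min (p j) (q j) / max P Q : ℝ≥0)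
        ≤ (∑ j ∈ t, Real.nnabs ((p j : ℝ) - q j)) / L := by
      rw [tsub_le_iff_right, ← Finset.sum_div]
      calc (1 : ℝ≥0) = max P Q / max P Q := (div_self hM0.ne').symm
        _ ≤ ((∑ j ∈ t, Real.nnabs ((p j : ℝ) - q j)) + ∑ j ∈ t, min (p j) (q j)) / max P Q := by
          gcongr
        _ ≤ _ := by
          rw [add_div]
          gcongr
          exact hLp.trans (le_max_left _ _)
    have h2 := NNReal.coe_le_coe.2 h1
    rw [NNReal.coe_div, NNReal.coe_sum] at h2
    simpa [Real.coe_nnabs] using h2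

end Weights

/-! ### Summing the block comparison over all cells. -/

section Estimate

variable {d n : ℕ} [NeZero n] {Y : Set (Space d)} {μ : Measure (Space d)}

theorem sum_ofReal_abs_measure_reflect_le [IsFiniteMeasure μ] (hac : μ ≪ volume)
    (hu : Integrable (density μ)) {s : ℕ} (hs : s ≤ 1) (S : Finset (Fin d)) :
    ∑ i ∈ interiorCells d n, ENNReal.ofReal
        |μ.real (cell (reflect (fun _ => s) S i)) - μ.real (cell (reflect (fun _ => 1 - s) S i))|
      ≤ 2 ^ d * (ENNReal.ofReal (2 * Real.sqrt d / n) * totalVariation (density μ)) := by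
  classical
  -- On each of the `2^d` parity classes the two reflections differ by one fixed vector with entries
  -- `0` and `±2`, so the translation estimate applies to each class.
  rw [← Finset.sum_fiberwise (interiorCells d n)
    (fun i : Index d n => fun l => decide (((i l : ℕ) + s) % 2 = 0))]
  refine (Finset.sum_le_card_nsmul _ _
    (ENNReal.ofReal (2 * Real.sqrt d / n) * totalVariation (density μ)) fun p _ => ?_).trans ?_
  · rw [← ENNReal.ofReal_sum_of_nonneg fun _ _ => abs_nonneg _]
    refine ofReal_sum_abs_measure_cell_sub_le hac hu _ _ _
      ((reflect_injOn _ S).mono fun i hi => Finset.mem_of_mem_filter i hi)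
      (fun l => if l ∈ S then (if p l then -2 else 2) else 0) ?_ ?_
    · intro l
      split_ifs <;> simp
    · intro i hi l
      rw [Finset.mem_filter] at hi
      have h1 := mem_interiorCells.1 hi.1 l
      have h2 : p l = decide (((i l : ℕ) + s) % 2 = 0) := by rw [← hi.2]
      by_cases hl : l ∈ S
      · simp only [reflect, if_pos hl, partner_val h1.2, h2, decide_eq_true_eq]
        split_ifs <;> omega
      · simp [reflect, hl]
  · simp

theorem IsAdapted.compositeMarginal_block_eq [IsFiniteMeasure μ]
    {π : Measure (Space d × Space d)} (h : IsAdapted n Y μ π)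
    (hpos : ∀ i : Index d n, μ (cell i) ≠ 0) {s : ℕ} (hs : s ≤ 1) {i : Index d n}
    (hi : i ∈ interiorCells d n) :
    compositeMarginal μ π (block s i) = ∑ S : Finset (Fin d),
      ((μ (cell (reflect (fun _ => s) S i))).toNNReal /
        ∑ S' : Finset (Fin d), (μ (cell (reflect (fun _ => s) S' i))).toNNReal) •
          cellMarginal μ π (reflect (fun _ => s) S i) := by
  rw [h.compositeMarginal_eq hpos, sum_block_eq hs hi, sum_block_eq hs hi]
  refine Finset.sum_congr rfl fun S _ => ?_
  have h0 : ∑ S' : Finset (Fin d), (μ (cell (reflect (fun _ => s) S' i))).toNNReal ≠ 0 := by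
    intro h0
    have := Finset.sum_eq_zero_iff.1 h0 S (Finset.mem_univ S)
    rw [ENNReal.toNNReal_eq_zero_iff] at this
    exact this.elim (hpos _) (measure_ne_top _ _)
  rw [ENNReal.smul_def, ENNReal.coe_div h0, ENNReal.ofNNReal_finsetSum,
    ENNReal.coe_toNNReal (measure_ne_top _ _)]
  simp_rw [ENNReal.coe_toNNReal (measure_ne_top μ _)]

theorem IsAdapted.wasserstein_block_le [IsFiniteMeasure μ] (hY : MeasurableSet Y)
    {π : Measure (Space d × Space d)} (h : IsAdapted n Y μ π) {M : ℝ≥0} (hM : 0 < M)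
    (hm : ∀ i : Index d n, M ≤ μ (cell i)) {s : ℕ} (hs : s ≤ 1) {i : Index d n}
    (hi : i ∈ interiorCells d n) :
    wasserstein (compositeMarginal μ π (block s i)) (compositeMarginal μ π (block (1 - s) i))
      ≤ ∑ S : Finset (Fin d), wasserstein (cellMarginal μ π (reflect (fun _ => s) S i))
          (cellMarginal μ π (reflect (fun _ => 1 - s) S i))
        + Metric.ediam Y * (∑ S : Finset (Fin d), ENNReal.ofReal
            |μ.real (cell (reflect (fun _ => s) S i))
              - μ.real (cell (reflect (fun _ => 1 - s) S i))|) / (2 ^ d * M) := by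
  have hpos : ∀ i : Index d n, μ (cell i) ≠ 0 := fun i h0 => by
    have := hm i
    rw [h0, nonpos_iff_eq_zero, ENNReal.coe_eq_zero] at this
    exact hM.ne' this
  have hprob : ∀ j : Index d n, IsProbabilityMeasure (cellMarginal μ π j) := fun j =>
    h.isProbabilityMeasure_cellMarginal (hpos j)
  have hsum : ∀ s : ℕ, 2 ^ d * M ≤ ∑ S : Finset (Fin d),
      (μ (cell (reflect (fun _ => s) S i))).toNNReal := by
    intro s
    have := Finset.card_nsmul_le_sum (Finset.univ : Finset (Finset (Fin d)))
      (fun S => (μ (cell (reflect (fun _ => s) S i))).toNNReal) M fun S _ =>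
        ENNReal.le_toNNReal_of_coe_le (hm _) (measure_ne_top _ _)
    simpa using this
  rw [h.compositeMarginal_block_eq hpos hs hi,
    h.compositeMarginal_block_eq hpos (s := 1 - s) (by omega) hi]
  have key := wasserstein_normalized_le (Finset.univ : Finset (Finset (Fin d))) (Y := Y)
    (fun S => (μ (cell (reflect (fun _ => s) S i))).toNNReal)
    (fun S => (μ (cell (reflect (fun _ => 1 - s) S i))).toNNReal) (L := 2 ^ d * M)
    (by positivity) (hsum s) (hsum (1 - s))
    (fun S => cellMarginal μ π (reflect (fun _ => s) S i))
    (fun S => cellMarginal μ π (reflect (fun _ => 1 - s) S i))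
    (fun _ => h.cellMarginal_compl hY _) (fun _ => h.cellMarginal_compl hY _)
  refine key.trans (le_of_eq ?_)
  push_cast
  rfl

theorem IsAdapted.sum_wasserstein_cellMarginal_le [IsFiniteMeasure μ]
    {π : Measure (Space d × Space d)} (h : IsAdapted n Y μ π)
    (hpos : ∀ i : Index d n, μ (cell i) ≠ 0) {s : ℕ} (hs : s ≤ 1) (S : Finset (Fin d)) :
    ∑ i ∈ interiorCells d n, wasserstein (cellMarginal μ π (reflect (fun _ => s) S i))
        (cellMarginal μ π (reflect (fun _ => 1 - s) S i))
      ≤ 2 * d * ((n : ℝ≥0∞) ^ (d - 1) * WTVB μ n π) := by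
  have hprob : ∀ j : Index d n, IsProbabilityMeasure (cellMarginal μ π j) := fun j =>
    h.isProbabilityMeasure_cellMarginal (hpos j)
  have hn : (n : ℝ≥0∞) ^ (d - 1) ≠ 0 := pow_ne_zero _ (by exact_mod_cast NeZero.ne n)
  rw [WTVB, ← mul_assoc ((n : ℝ≥0∞) ^ (d - 1)), ENNReal.mul_inv_cancel hn (by finiteness), one_mul]
  exact sum_reflect_le (fun i j => wasserstein (cellMarginal μ π i) (cellMarginal μ π j))
    (fun i => wasserstein_self _) (fun i j => wasserstein_comm _ _)
    (fun i j k => wasserstein_triangle _ _ _) hs S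

theorem IsAdapted.sum_wasserstein_block_le [IsFiniteMeasure μ] (hY : MeasurableSet Y)
    (hac : μ ≪ volume) (hu : Integrable (density μ))
    {π : Measure (Space d × Space d)} (h : IsAdapted n Y μ π) {M : ℝ≥0} (hM : 0 < M)
    (hm : ∀ i : Index d n, M ≤ μ (cell i)) {s : ℕ} (hs : s ≤ 1) :
    ∑ i : Index d n, wasserstein (compositeMarginal μ π (block s i))
        (compositeMarginal μ π (block (1 - s) i))
      ≤ 2 ^ d * (2 * d * ((n : ℝ≥0∞) ^ (d - 1) * WTVB μ n π))
        + Metric.ediam Y * (2 ^ d * (2 ^ d *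
            (ENNReal.ofReal (2 * Real.sqrt d / n) * totalVariation (density μ)))) / (2 ^ d * M)
        + 2 * d * (n : ℝ≥0∞) ^ (d - 1) * Metric.ediam Y := by
  have hpos : ∀ i : Index d n, μ (cell i) ≠ 0 := fun i h0 => by
    have := hm i
    rw [h0, nonpos_iff_eq_zero, ENNReal.coe_eq_zero] at this
    exact hM.ne' this
  rw [← Finset.sum_add_sum_compl (interiorCells d n)]
  refine add_le_add ?_ ?_
  · refine (Finset.sum_le_sum fun i hi => h.wasserstein_block_le hY hM hm hs hi).trans ?_
    rw [Finset.sum_add_distrib]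
    simp_rw [div_eq_mul_inv]
    rw [← Finset.sum_mul, ← Finset.mul_sum, Finset.sum_comm,
      Finset.sum_comm (s := interiorCells d n)]
    -- The factor `2^d` here counts the sets `S`, that is, the cells of a block.
    have hc : ∀ (f : Finset (Fin d) → ℝ≥0∞) (B : ℝ≥0∞), (∀ S, f S ≤ B) →
        ∑ S, f S ≤ 2 ^ d * B := fun f B hB => by
      simpa using Finset.sum_le_card_nsmul Finset.univ f B fun S _ => hB S
    gcongr
    · exact hc _ _ fun S => h.sum_wasserstein_cellMarginal_le hpos hs S
    · exact hc _ _ fun S => sum_ofReal_abs_measure_reflect_le hac hu hs S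
  -- Blocks at the boundary may be smaller and unmatched, so the trivial bound is used there.
  · have hb : ∀ i : Index d n, wasserstein (compositeMarginal μ π (block s i))
        (compositeMarginal μ π (block (1 - s) i)) ≤ Metric.ediam Y := by
      intro i
      have h1 := h.isProbabilityMeasure_compositeMarginal hpos ⟨i, self_mem_block s i⟩
      have h2 := h.isProbabilityMeasure_compositeMarginal hpos ⟨i, self_mem_block (1 - s) i⟩
      simpa using wasserstein_le_ediam_mul (h.compositeMarginal_compl hY (block s i))
        (h.compositeMarginal_compl hY (block (1 - s) i)) (by simp)
    refine (Finset.sum_le_card_nsmul _ _ _ fun i _ => hb i).trans ?_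
    rw [nsmul_eq_mul]
    gcongr
    exact_mod_cast card_compl_interiorCells_le (d := d) (n := n)

end Estimate

/-! ### The quantitative increment bound and the main theorem. -/

theorem iterShift_le_one (k : ℕ) : iterShift k ≤ 1 := by
  unfold iterShift; split_ifs <;> simp

theorem iterShift_succ (k : ℕ) : iterShift (k + 1) = 1 - iterShift k := by
  unfold iterShift
  by_cases h : Odd k
  · rw [if_pos h, if_neg (by simpa [Nat.odd_add_one] using h)]
  · rw [if_neg h, if_pos (by simpa [Nat.odd_add_one] using h)]

theorem verticalDist_trajectory_le {d n : ℕ} (hd : 1 ≤ d) [NeZero n] {Y : Set (Space d)}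
    (hY : MeasurableSet Y) {μ : Measure (Space d)} [IsFiniteMeasure μ] (hμX : μ (cube d)ᶜ = 0)
    (hac : μ ≪ volume) {M_l M_u : ℝ≥0} (hMl : 0 < M_l)
    (hdens : ∀ᵐ x ∂(volume.restrict (cube d)),
      (M_l : ℝ) ≤ density μ x ∧ density μ x ≤ (M_u : ℝ))
    (hu : Integrable (density μ)) {P : LevelData d} (hP : P.IsAdmissible Y μ n)
    {π : ℕ → Measure (Space d × Space d)} (hπ : IsIterates n P π) (k : ℕ) :
    verticalDist μ (trajectory μ n π ((k : ℝ) / n)) (trajectory μ n π (((k : ℝ) + 1) / n))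
      ≤ (M_u : ℝ≥0∞) / n * (((2 ^ (d + 1) * d : ℝ≥0) : ℝ≥0∞) * WTVB μ n (π k)
        + 2 ^ (d + 1) * Metric.ediam Y * (ENNReal.ofReal (Real.sqrt d) / M_l)
          * totalVariation (density μ)
        + 2 * d * Metric.ediam Y) := by
  have hn0 : (n : ℝ≥0) ≠ 0 := by exact_mod_cast NeZero.ne n
  have hnE : (n : ℝ≥0∞) ≠ 0 := by exact_mod_cast NeZero.ne n
  set M : ℝ≥0 := M_l * ((n : ℝ≥0) ^ d)⁻¹ with hMdef
  have hMcoe : (M : ℝ≥0∞) = M_l * ((n : ℝ≥0∞) ^ d)⁻¹ := by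
    rw [hMdef, ENNReal.coe_mul, ENNReal.coe_inv (pow_ne_zero _ hn0)]
    simp
  have hM : 0 < M := by positivity
  have hm : ∀ i : Index d n, M ≤ μ (cell i) := fun i => by
    rw [hMcoe]
    exact le_measure_cell hac (hdens.mono fun x hx => hx.1) i
  have hpos : ∀ i : Index d n, μ (cell i) ≠ 0 := fun i h0 => by
    have := hm i
    rw [h0, nonpos_iff_eq_zero, ENNReal.coe_eq_zero] at this
    exact hM.ne' this
  rw [verticalDist_trajectory_eq (IsCellRegular.of_absolutelyContinuous hμX hac) hpos hP hY hπ k]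
  refine (Finset.sum_le_sum fun i _ => mul_le_mul_left
    (measure_cell_le hac (hdens.mono fun x hx => hx.2) i) _).trans ?_
  rw [← Finset.mul_sum, iterShift_succ]
  refine (mul_le_mul_right ((hπ.isAdapted hP hY k).sum_wasserstein_block_le hY hac hu hM hm
    (iterShift_le_one k)) _).trans (le_of_eq ?_)
  -- This removes the truncated subtraction in `n ^ (d - 1)`. The inverses are then treated as free
  -- variables, and the powers of `n` and `2` cancel through `h2`, `h3`, `h4`.
  obtain ⟨e, rfl⟩ : ∃ e, d = e + 1 := ⟨d - 1, by omega⟩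
  have hsq : ENNReal.ofReal (2 * Real.sqrt (e + 1 : ℕ) / n)
      = 2 * ENNReal.ofReal (Real.sqrt (e + 1 : ℕ)) * (n : ℝ≥0∞)⁻¹ := by
    rw [ENNReal.ofReal_div_of_pos (by exact_mod_cast NeZero.pos n),
      ENNReal.ofReal_mul zero_le_two, div_eq_mul_inv]
    simp
  have hinv : ((2 : ℝ≥0∞) ^ (e + 1) * M)⁻¹
      = (2 ^ (e + 1))⁻¹ * ((M_l : ℝ≥0∞)⁻¹ * (n : ℝ≥0∞) ^ (e + 1)) := by
    rw [hMcoe, ENNReal.mul_inv (by simp) (by simp), ENNReal.mul_inv (by simp [hMl.ne']) (by simp), inv_inv]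
  have h2 : (2 : ℝ≥0∞) ^ (e + 1) * (2 ^ (e + 1))⁻¹ = 1 :=
    ENNReal.mul_inv_cancel (by simp) (by finiteness)
  have h3 : (n : ℝ≥0∞) ^ e * ((n : ℝ≥0∞) ^ e)⁻¹ = 1 :=
    ENNReal.mul_inv_cancel (pow_ne_zero _ hnE) (by finiteness)
  have h4 : (n : ℝ≥0∞) * (n : ℝ≥0∞)⁻¹ = 1 := ENNReal.mul_inv_cancel hnE (by finiteness)
  have h5 : ((n : ℝ≥0∞) ^ (e + 1))⁻¹ = ((n : ℝ≥0∞) ^ e)⁻¹ * (n : ℝ≥0∞)⁻¹ := by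
    rw [pow_succ, ENNReal.mul_inv (by simp) (by simp)]
  rw [hsq, h5, div_eq_mul_inv, hinv, div_eq_mul_inv, div_eq_mul_inv, Nat.add_sub_cancel]
  push_cast
  generalize ((n : ℝ≥0∞) ^ e)⁻¹ = a at *
  generalize (n : ℝ≥0∞)⁻¹ = b at *
  generalize ((2 : ℝ≥0∞) ^ (e + 1))⁻¹ = c at *
  generalize (M_l : ℝ≥0∞)⁻¹ = r
  generalize ENNReal.ofReal _ = q
  generalize totalVariation _ = TV
  generalize WTVB _ _ _ = V
  generalize Metric.ediam Y = D
  calc _ = (M_u : ℝ≥0∞) * b * (((n : ℝ≥0∞) ^ e * a) * (2 ^ (e + 1 + 1) * (e + 1) * V)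
        + ((2 ^ (e + 1) * c) * ((n : ℝ≥0∞) ^ e * a) * (n * b)) *
          (2 ^ (e + 1 + 1) * D * (q * r) * TV)
        + ((n : ℝ≥0∞) ^ e * a) * (2 * (e + 1) * D)) := by ring
    _ = _ := by rw [h2, h3, h4]; ring

end DomDec

theorem mainTheorem8 (d : ℕ) (hd : 1 ≤ d) :
    ∃ C : ℝ≥0,
      ∀ (Y : Set (DomDec.Space d)) (_hY : IsCompact Y)
        (μ : Measure (DomDec.Space d)) (_hμ : IsProbabilityMeasure μ)
        (_hμX : μ (DomDec.cube d)ᶜ = 0) (_hμac : μ ≪ volume)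
        (M_l M_u : ℝ≥0) (_hMl : 0 < M_l)
        (_hdens : ∀ᵐ x ∂(volume.restrict (DomDec.cube d)),
          (M_l : ℝ) ≤ DomDec.density μ x ∧ DomDec.density μ x ≤ (M_u : ℝ))
        (_hBV : DomDec.IsBV (DomDec.density μ))
        (P : ℕ → DomDec.LevelData d)
        (_hP : ∀ n, Even n → 0 < n → (P n).IsAdmissible Y μ n)
        (π : ℕ → ℕ → Measure (DomDec.Space d × DomDec.Space d))
        (_hπ : ∀ n, Even n → 0 < n → DomDec.IsIterates n (P n) (π n)),
        (∀ n, Even n → 0 < n → ∀ k : ℕ,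
          DomDec.verticalDist μ (DomDec.trajectory μ n (π n) ((k : ℝ) / n))
              (DomDec.trajectory μ n (π n) (((k : ℝ) + 1) / n))
            ≤ (M_u : ℝ≥0∞) / n *
              (C * DomDec.WTVB μ n (π n k)
                + 2 ^ (d + 1) * Metric.ediam Y * (ENNReal.ofReal (Real.sqrt d) / M_l)
                    * DomDec.totalVariation (DomDec.density μ)
                + 2 * d * Metric.ediam Y)) ∧
        ((∃ B : ℝ≥0, ∀ n, Even n → 0 < n → ∀ k : ℕ, DomDec.WTVB μ n (π n k) ≤ B) →
          ∃ K : ℝ≥0, ∀ n, Even n → 0 < n → ∀ k : ℕ,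
            DomDec.verticalDist μ (DomDec.trajectory μ n (π n) ((k : ℝ) / n))
                (DomDec.trajectory μ n (π n) (((k : ℝ) + 1) / n))
              ≤ (K : ℝ≥0∞) / n) := by
  -- The constant counts `2^d` matched pairs of cells, `d` directions and two parities.
  refine ⟨2 ^ (d + 1) * d, fun Y hY μ hμ hμX hac M_l M_u hMl hdens hBV P hP π hπ => ?_⟩
  have key : ∀ n, Even n → 0 < n → ∀ k : ℕ, _ := fun n hn hn0 k =>
    haveI : NeZero n := ⟨hn0.ne'⟩
    DomDec.verticalDist_trajectory_le hd hY.measurableSet hμX hac hMl hdens hBV.1 (hP n hn hn0)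
      (hπ n hn hn0) k
  refine ⟨key, ?_⟩
  rintro ⟨B, hB⟩
  have hD : Metric.ediam Y ≠ ∞ := hY.isBounded.ediam_ne_top
  have hTV : DomDec.totalVariation (DomDec.density μ) ≠ ∞ := hBV.2.ne
  have hMl' : (M_l : ℝ≥0∞) ≠ 0 := by simpa using hMl.ne'
  set K : ℝ≥0∞ := M_u * (((2 ^ (d + 1) * d : ℝ≥0) : ℝ≥0∞) * B
    + 2 ^ (d + 1) * Metric.ediam Y * (ENNReal.ofReal (Real.sqrt d) / M_l)
      * DomDec.totalVariation (DomDec.density μ)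
    + 2 * d * Metric.ediam Y) with hK
  have hKt : K ≠ ∞ := by
    have : ENNReal.ofReal (Real.sqrt d) / M_l ≠ ∞ := ENNReal.div_ne_top ENNReal.ofReal_ne_top hMl'
    finiteness
  refine ⟨K.toNNReal, fun n hn hn0 k => (key n hn hn0 k).trans ?_⟩
  rw [ENNReal.coe_toNNReal hKt, hK, ENNReal.mul_div_right_comm]
  gcongr
  exact hB n hn hn0 k
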